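/- Let $A,B,K,L\in\mathbb{R}$. The origin is a nilpotent center of the planar differential system $$\dot x = y + Axy + By^2,\qquad \dot y = -x^3 + Kxy^2 + Ly^3$$ if and only if $$AB-3L=0\quad\text{and}\quad AB(A^2-2K)=0.$$ Here a singular point $p$ of a planar system is a center if it has a neighborhood $U$ such that all the orbits of $U\setminus\{p\}$ are (nonconstant) periodic orbits. A center of an analytic system is nilpotent if, after an affine change of variables sending $p$ to the origin and a rescaling of the time by a nonzero constant, the system can be written near the origin as $\dot x=y+F_1(x,y)$, $\dot y=F_2(x,y)$, where $F_1,F_2$ are real analytic near the origin without constant and linear terms. -/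

import Mathlib

open scoped Topology

/-- The singular point `p` of the planar differential system `ż = X z` is a center: it has a
neighborhood `U` such that every orbit of `U \ {p}` is a (nonconstant) periodic orbit. -/
def IsCenter (X : ℝ × ℝ → ℝ × ℝ) (p : ℝ × ℝ) : Prop :=
  X p = 0 ∧
    ∃ U ∈ 𝓝 p, ∀ q ∈ U, q ≠ p →
      ∃ (γ : ℝ → ℝ × ℝ) (T : ℝ), γ 0 = q ∧ (∀ t, HasDerivAt γ (X (γ t)) t) ∧
        (∀ t, γ t ∈ U ∧ γ t ≠ p) ∧
        0 < T ∧ Function.Periodic γ T ∧ ∃ t, γ t ≠ q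

/-- After an affine change of variables `u = Φ z` sending `p` to the origin and a rescaling of
the time by a nonzero constant `c`, the system `ż = X z` takes near the origin the form
`u̇₁ = u₂ + F₁(u₁, u₂)`, `u̇₂ = F₂(u₁, u₂)`, where `F₁`, `F₂` are real analytic at the origin,
without constant and linear terms. -/
def HasNilpotentForm (X : ℝ × ℝ → ℝ × ℝ) (p : ℝ × ℝ) : Prop :=
  ∃ (Φ : (ℝ × ℝ) ≃ᵃ[ℝ] (ℝ × ℝ)) (c : ℝ) (F₁ F₂ : ℝ × ℝ → ℝ),
    Φ p = 0 ∧ c ≠ 0 ∧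
    AnalyticAt ℝ F₁ 0 ∧ F₁ 0 = 0 ∧ fderiv ℝ F₁ 0 = 0 ∧
    AnalyticAt ℝ F₂ 0 ∧ F₂ 0 = 0 ∧ fderiv ℝ F₂ 0 = 0 ∧
    ∀ᶠ u in 𝓝 (0 : ℝ × ℝ), c • Φ.linear (X (Φ.symm u)) = (u.2 + F₁ u, F₂ u)

/-- `p` is a nilpotent center of the planar differential system `ż = X z`. -/
def IsNilpotentCenter (X : ℝ × ℝ → ℝ × ℝ) (p : ℝ × ℝ) : Prop :=
  IsCenter X p ∧ HasNilpotentForm X p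

/-- The vector field of the system
`ẋ = y + A x y + B y²`, `ẏ = -x³ + K x y² + L y³`. -/
def cubicField (A B K L : ℝ) (z : ℝ × ℝ) : ℝ × ℝ :=
  (z.2 + A * z.1 * z.2 + B * z.2 ^ 2, -z.1 ^ 3 + K * z.1 * z.2 ^ 2 + L * z.2 ^ 3)

/-!
Give the plane the parabolic weights `(1, 2)`, for which the leading part `(y, -x ^ 3)` of the
system is Hamiltonian and turns around the origin.

*Necessity.* A Lyapunov function is built term by term: its quasi-homogeneous parts solve
homological equations, each solvable up to a multiple of a fixed positive form. The first two
multiples which need not vanish are proportional to `A * B - 3 * L` and `A * B * (A ^ 2 - 2 * K)`;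
a nonzero one makes the Lyapunov function, up to reversing time, strictly decreasing along the
orbits.

*Sufficiency.* In the polar coordinates `x = ρ cos θ`, `y = ρ ² sin θ` the orbits near the origin
are graphs over `θ` of the solutions of a regular differential equation. They close up after one
turn because the system is reversible with respect to an axis if `A = 0` or `B = 0`, and has the
integrating factor `exp (-A * x)` if `A ^ 2 = 2 * K`.
-/

theorem forall_lt_of_forall_ne {f : ℝ → ℝ} {r : ℝ} (hf : Continuous f) (h0 : f 0 < r)
    (h : ∀ t > 0, (∀ s ∈ Set.Icc 0 t, f s ≤ r) → f t ≠ r) : ∀ t ≥ 0, f t < r := by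
  intro t ht
  by_contra! hrt
  obtain ⟨u, hu, hfu⟩ : ∃ u ∈ Set.Icc 0 t, f u = r :=
    intermediate_value_Icc ht hf.continuousOn ⟨h0.le, hrt⟩
  set S : Set ℝ := {s | 0 ≤ s ∧ f s = r}
  have hS : IsClosed S := isClosed_Ici.inter (isClosed_eq hf continuous_const)
  have hSbdd : BddBelow S := ⟨0, fun s hs => hs.1⟩
  obtain ⟨hτ, hfτ⟩ : sInf S ∈ S := hS.csInf_mem ⟨u, hu.1, hfu⟩ hSbdd
  have hτpos : 0 < sInf S := hτ.lt_of_ne fun h => by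
    rw [← h] at hfτ
    exact h0.ne hfτ
  refine h _ hτpos (fun s hs => ?_) hfτ
  by_contra! hrs
  obtain ⟨v, hv, hfv⟩ : ∃ v ∈ Set.Icc 0 s, f v = r :=
    intermediate_value_Icc hs.1 hf.continuousOn ⟨h0.le, hrs.le⟩
  have hτs : sInf S = s := hs.2.antisymm' ((csInf_le hSbdd ⟨hv.1, hfv⟩).trans hv.2)
  rw [← hτs, hfτ] at hrs
  exact hrs.false

theorem IsCenter.const_smul {X : ℝ × ℝ → ℝ × ℝ} {p : ℝ × ℝ} (hX : IsCenter X p) {c : ℝ}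
    (hc : c ≠ 0) : IsCenter (c • X) p := by
  obtain ⟨hp, U, hU, h⟩ := hX
  refine ⟨by simp [hp], U, hU, fun q hq hqp => ?_⟩
  obtain ⟨γ, T, h0, hγ, hmem, hT, hper, t, ht⟩ := h q hq hqp
  refine ⟨fun t => γ (c * t), T / |c|, by simpa using h0, fun t => ?_, fun t => hmem _,
    by positivity, fun t => ?_, t / c, by simpa [mul_div_cancel₀ _ hc] using ht⟩
  · simpa [Function.comp_def] using (hγ (c * t)).scomp t ((hasDerivAt_id t).const_mul c)
  · rcases abs_choice c with hc' | hc' <;> rw [hc'] <;> simp only [mul_add]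
    · rw [mul_div_cancel₀ _ hc, hper]
    · rw [div_neg, mul_neg, mul_div_cancel₀ _ hc, ← sub_eq_add_neg, hper.sub_eq]

/-- The derivative of the function `f` along the orbits of the vector field `X`. -/
noncomputable def lieDeriv {E : Type*} [NormedAddCommGroup E] [NormedSpace ℝ E] (X : E → E)
    (f : E → ℝ) (z : E) : ℝ :=
  fderiv ℝ f z (X z)

theorem lt_of_lieDeriv_neg {E : Type*} [NormedAddCommGroup E] [NormedSpace ℝ E] {X : E → E}
    {V : E → ℝ} {γ : ℝ → E} {t : ℝ} (ht : 0 < t) (hγ : ∀ s, HasDerivAt γ (X (γ s)) s)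
    (hV : ∀ s ∈ Set.Icc 0 t, DifferentiableAt ℝ V (γ s) ∧ lieDeriv X V (γ s) < 0) :
    V (γ t) < V (γ 0) := by
  have hderiv : ∀ s ∈ Set.Icc 0 t, HasDerivAt (V ∘ γ) (lieDeriv X V (γ s)) s :=
    fun s hs => (hV s hs).1.hasFDerivAt.comp_hasDerivAt s (hγ s)
  refine strictAntiOn_of_deriv_neg (convex_Icc 0 t)
    (fun s hs => (hderiv s hs).continuousAt.continuousWithinAt) (fun s hs => ?_)
    (Set.left_mem_Icc.2 ht.le) (Set.right_mem_Icc.2 ht.le) ht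
  rw [(hderiv s (interior_subset hs)).deriv]
  exact (hV s (interior_subset hs)).2

/-- A strict Lyapunov function traps the orbits starting near `p` in a ball and decreases along
them, so that they do not return. -/
theorem not_isCenter_of_strictLyapunov {X : ℝ × ℝ → ℝ × ℝ} {p : ℝ × ℝ} {V : ℝ × ℝ → ℝ}
    (hVp : V p = 0) (hVc : ContinuousAt V p)
    (hV : ∀ᶠ z in 𝓝[≠] p, 0 < V z ∧ DifferentiableAt ℝ V z ∧ lieDeriv X V z < 0) :
    ¬IsCenter X p := by
  rintro ⟨-, U, hU, hcenter⟩
  obtain ⟨ε, hε, hball⟩ : ∃ ε > 0, ∀ z ∈ Metric.closedBall p ε, z ≠ p →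
      0 < V z ∧ DifferentiableAt ℝ V z ∧ lieDeriv X V z < 0 := by
    obtain ⟨ε, hε, h⟩ := Metric.nhds_basis_closedBall.eventually_iff.1
      (eventually_nhdsWithin_iff.1 hV)
    exact ⟨ε, hε, fun z hz => h hz⟩
  have hsphere : ∀ z ∈ Metric.sphere p ε, 0 < V z ∧ DifferentiableAt ℝ V z := fun z hz =>
    have h := hball z (Metric.sphere_subset_closedBall hz) (Metric.ne_of_mem_sphere hz hε.ne')
    ⟨h.1, h.2.1⟩
  obtain ⟨m, hm, hmV⟩ : ∃ m > 0, ∀ z ∈ Metric.sphere p ε, m ≤ V z :=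
    (isCompact_sphere p ε).exists_forall_le'
      (fun z hz => (hsphere z hz).2.continuousAt.continuousWithinAt) fun z hz => (hsphere z hz).1
  obtain ⟨q, ⟨hqU, hqε, hqm⟩, hqp⟩ : ∃ q, (q ∈ U ∧ dist q p < ε ∧ V q < m) ∧ q ≠ p := by
    have hnear : ∀ᶠ q in 𝓝 p, q ∈ U ∧ dist q p < ε ∧ V q < m := by
      filter_upwards [hU, Metric.ball_mem_nhds p hε, hVc.eventually_lt_const (by rwa [hVp])]
        with q hqU hqε hqm using ⟨hqU, hqε, hqm⟩
    have hpunctured : ∀ᶠ q in 𝓝[≠] p, (q ∈ U ∧ dist q p < ε ∧ V q < m) ∧ q ≠ p :=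
      (hnear.filter_mono nhdsWithin_le_nhds).and self_mem_nhdsWithin
    exact hpunctured.exists
  obtain ⟨γ, T, h0, hγ, hmem, hT, hper, -⟩ := hcenter q hqU hqp
  have hγc : Continuous γ := continuous_iff_continuousAt.2 fun t => (hγ t).continuousAt
  have hdecr : ∀ t > 0, (∀ s ∈ Set.Icc 0 t, dist (γ s) p ≤ ε) → V (γ t) < V (γ 0) :=
    fun t ht hs => lt_of_lieDeriv_neg ht hγ fun s hst => (hball _ (hs s hst) (hmem s).2).2
  have htrap : ∀ t ≥ 0, dist (γ t) p < ε :=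
    forall_lt_of_forall_ne (hγc.dist continuous_const) (by rwa [h0]) fun t ht hs hεt =>
      ((hdecr t ht hs).trans (h0 ▸ hqm)).not_ge (hmV _ hεt)
  have hreturn : V (γ T) < V (γ 0) := hdecr T hT fun s hs => (htrap s hs.1).le
  rw [hper.eq] at hreturn
  exact hreturn.false

/-- A neighborhood as in `IsCenter` comes for free: the points on such orbits form an invariant
set. -/
theorem isCenter_of_eventually_periodic {X : ℝ × ℝ → ℝ × ℝ} {p : ℝ × ℝ} (hp : X p = 0)
    (h : ∀ᶠ q in 𝓝[≠] p, ∃ (γ : ℝ → ℝ × ℝ) (T : ℝ), γ 0 = q ∧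
      (∀ t, HasDerivAt γ (X (γ t)) t) ∧ (∀ t, γ t ≠ p) ∧ 0 < T ∧ Function.Periodic γ T ∧
      ∀ s, ∃ t, γ t ≠ γ s) : IsCenter X p := by
  refine ⟨hp, _, eventually_nhdsWithin_iff.1 h, fun q hq hqp => ?_⟩
  obtain ⟨γ, T, h0, hγ, hne, hT, hper, hnc⟩ := hq hqp
  refine ⟨γ, T, h0, hγ, fun t => ⟨fun _ => ?_, hne t⟩, hT, hper, ?_⟩
  · refine ⟨fun u => γ (u + t), T, by simp, fun u => (hγ (u + t)).comp_add_const u t,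
      fun u => hne _, hT, fun u => ?_, fun s => ?_⟩
    · change γ (u + T + t) = γ (u + t)
      rw [add_right_comm, hper]
    · obtain ⟨r, hr⟩ := hnc (s + t)
      exact ⟨r - t, by simpa using hr⟩
  · obtain ⟨t, ht⟩ := hnc 0
    exact ⟨t, by rwa [h0] at ht⟩

/-- The dilation of the plane with the parabolic weights `(1, 2)`. -/
def parabolicDilation (ρ : ℝ) (z : ℝ × ℝ) : ℝ × ℝ :=
  (ρ * z.1, ρ ^ 2 * z.2)

/-- The Euclidean unit circle, a transversal to the parabolic dilations. It is not
`Metric.sphere 0 1`, because `ℝ × ℝ` carries the supremum norm. -/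
def unitCircle : Set (ℝ × ℝ) :=
  {u | u.1 ^ 2 + u.2 ^ 2 = 1}

/-- The parabolic dilation factor which carries the unit circle to `z`, that is, the nonnegative
solution `ρ` of `ρ ^ 4 = z.1 ^ 2 * ρ ^ 2 + z.2 ^ 2`. -/
noncomputable def parabolicNorm (z : ℝ × ℝ) : ℝ :=
  √((z.1 ^ 2 + √(z.1 ^ 4 + 4 * z.2 ^ 2)) / 2)

theorem isCompact_unitCircle : IsCompact unitCircle := by
  refine (isCompact_Icc (a := (-1 : ℝ)) (b := 1)).prod
    (isCompact_Icc (a := (-1 : ℝ)) (b := 1)) |>.of_isClosed_subset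
    (isClosed_eq (by fun_prop) (by fun_prop)) fun u (hu : u.1 ^ 2 + u.2 ^ 2 = 1) => ?_
  exact ⟨abs_le.1 (abs_le_of_sq_le_sq (by linarith [sq_nonneg u.2]) zero_le_one),
    abs_le.1 (abs_le_of_sq_le_sq (by linarith [sq_nonneg u.1]) zero_le_one)⟩

theorem ne_zero_of_mem_unitCircle {u : ℝ × ℝ} (hu : u ∈ unitCircle) : u ≠ 0 := by
  rintro rfl
  simp [unitCircle] at hu

theorem cos_sin_mem_unitCircle (θ : ℝ) : (Real.cos θ, Real.sin θ) ∈ unitCircle :=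
  Real.cos_sq_add_sin_sq θ

theorem exists_eq_cos_sin_of_mem_unitCircle {u : ℝ × ℝ} (hu : u ∈ unitCircle) :
    ∃ θ, u = (Real.cos θ, Real.sin θ) := by
  have hnorm : ‖(⟨u.1, u.2⟩ : ℂ)‖ = 1 := by
    rw [Complex.norm_def, Complex.normSq_mk, ← pow_two, ← pow_two, hu, Real.sqrt_one]
  have hne : (⟨u.1, u.2⟩ : ℂ) ≠ 0 := norm_ne_zero_iff.1 (by rw [hnorm]; exact one_ne_zero)
  exact ⟨Complex.arg ⟨u.1, u.2⟩, by rw [Complex.cos_arg hne, Complex.sin_arg, hnorm]; simp⟩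

theorem parabolicDilation_ne_zero {ρ : ℝ} (hρ : 0 < ρ) {z : ℝ × ℝ} (hz : z ≠ 0) :
    parabolicDilation ρ z ≠ 0 := by
  contrapose! hz
  simp only [parabolicDilation, Prod.mk_eq_zero, mul_eq_zero, hρ.ne', false_or,
    pow_ne_zero 2 hρ.ne'] at hz
  exact Prod.ext hz.1 hz.2

theorem parabolicNorm_pos {z : ℝ × ℝ} (hz : z ≠ 0) : 0 < parabolicNorm z := by
  refine Real.sqrt_pos.2 (half_pos ?_)
  by_cases hx : z.1 = 0
  · have hy : z.2 ≠ 0 := fun hy => hz (Prod.ext hx hy)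
    have : 0 < √(z.1 ^ 4 + 4 * z.2 ^ 2) := Real.sqrt_pos.2 (by positivity)
    positivity
  · positivity

theorem parabolicNorm_pow_four (z : ℝ × ℝ) :
    parabolicNorm z ^ 4 = z.1 ^ 2 * parabolicNorm z ^ 2 + z.2 ^ 2 := by
  have hsq : parabolicNorm z ^ 2 = (z.1 ^ 2 + √(z.1 ^ 4 + 4 * z.2 ^ 2)) / 2 :=
    Real.sq_sqrt (by positivity)
  have hsqrt : √(z.1 ^ 4 + 4 * z.2 ^ 2) ^ 2 = z.1 ^ 4 + 4 * z.2 ^ 2 :=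
    Real.sq_sqrt (by positivity)
  rw [show parabolicNorm z ^ 4 = (parabolicNorm z ^ 2) ^ 2 by ring, hsq]
  linear_combination hsqrt / 4

theorem exists_eq_parabolicDilation {z : ℝ × ℝ} (hz : z ≠ 0) :
    ∃ u ∈ unitCircle, z = parabolicDilation (parabolicNorm z) u := by
  have hpos := parabolicNorm_pos hz
  refine ⟨(z.1 / parabolicNorm z, z.2 / parabolicNorm z ^ 2), ?_, ?_⟩
  · change (z.1 / parabolicNorm z) ^ 2 + (z.2 / parabolicNorm z ^ 2) ^ 2 = 1
    field_simp
    linarith [parabolicNorm_pow_four z]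
  · ext <;> simp only [parabolicDilation] <;> field_simp

theorem eventually_nhdsNE_zero_of_forall_parabolicDilation {p : ℝ × ℝ → Prop} {r : ℝ} (hr : 0 < r)
    (h : ∀ ρ ∈ Set.Ioo 0 r, ∀ u ∈ unitCircle, p (parabolicDilation ρ u)) :
    ∀ᶠ z in 𝓝[≠] 0, p z := by
  have hcont : Continuous parabolicNorm := by
    unfold parabolicNorm
    fun_prop
  have hsmall : ∀ᶠ z in 𝓝 (0 : ℝ × ℝ), parabolicNorm z < r :=
    hcont.continuousAt.eventually_lt_const (by simpa [parabolicNorm] using hr)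
  filter_upwards [hsmall.filter_mono nhdsWithin_le_nhds, self_mem_nhdsWithin] with z hzr hz
  obtain ⟨u, hu, hzu⟩ := exists_eq_parabolicDilation hz
  rw [hzu]
  exact h _ ⟨parabolicNorm_pos hz, hzr⟩ u hu

/-- Quasi-homogeneous functions of degree `n` for the weights `(1, 2)`. -/
def IsParabolicHomogeneous (f : ℝ × ℝ → ℝ) (n : ℕ) : Prop :=
  ∀ ρ > 0, ∀ z, f (parabolicDilation ρ z) = ρ ^ n * f z

/-- Quasi-homogeneous vector fields of degree `d` for the weights `(1, 2)`: differentiating along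
them raises the degree of quasi-homogeneous functions by `d`. -/
def IsParabolicHomogeneousField (X : ℝ × ℝ → ℝ × ℝ) (d : ℕ) : Prop :=
  ∀ ρ > 0, ∀ z, X (parabolicDilation ρ z) = ρ ^ d • parabolicDilation ρ (X z)

/-- The parabolic dilation with factor `ρ ≠ 0` as a linear automorphism of the plane. -/
noncomputable def parabolicDilationEquiv {ρ : ℝ} (hρ : ρ ≠ 0) : (ℝ × ℝ) ≃L[ℝ] ℝ × ℝ :=
  (ContinuousLinearEquiv.smulLeft (Units.mk0 ρ hρ)).prodCongr
    (ContinuousLinearEquiv.smulLeft (Units.mk0 (ρ ^ 2) (pow_ne_zero 2 hρ)))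

theorem isParabolicHomogeneous_lieDeriv {X : ℝ × ℝ → ℝ × ℝ} {f : ℝ × ℝ → ℝ} {n d : ℕ}
    (hf : IsParabolicHomogeneous f n) (hX : IsParabolicHomogeneousField X d) :
    IsParabolicHomogeneous (lieDeriv X f) (n + d) := by
  intro ρ hρ z
  have hcomp : f ∘ parabolicDilationEquiv hρ.ne' = ρ ^ n • f := funext (hf ρ hρ)
  have hfderiv : (fderiv ℝ f (parabolicDilation ρ z)).comp
      (parabolicDilationEquiv hρ.ne' : (ℝ × ℝ) →L[ℝ] ℝ × ℝ) = ρ ^ n • fderiv ℝ f z := by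
    rw [← Pi.smul_apply, ← fderiv_const_smul_field, ← hcomp,
      ContinuousLinearEquiv.comp_right_fderiv]
    rfl
  have happly : fderiv ℝ f (parabolicDilation ρ z) (parabolicDilation ρ (X z)) =
      ρ ^ n * fderiv ℝ f z (X z) := DFunLike.congr_fun hfderiv (X z)
  rw [lieDeriv, hX ρ hρ, map_smul, happly, smul_eq_mul, lieDeriv]
  ring

theorem IsParabolicHomogeneous.apply_zero {f : ℝ × ℝ → ℝ} {n : ℕ}
    (hf : IsParabolicHomogeneous f n) (hn : n ≠ 0) : f 0 = 0 := by
  have h2 : f 0 = 2 ^ n * f 0 := by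
    simpa [parabolicDilation, ← Prod.zero_eq_mk] using hf 2 two_pos 0
  have hpow : (1 : ℝ) < 2 ^ n := one_lt_pow₀ one_lt_two hn
  nlinarith

theorem IsParabolicHomogeneous.continuousAt_zero {f : ℝ × ℝ → ℝ} {n : ℕ}
    (hf : IsParabolicHomogeneous f n) (hn : n ≠ 0) (hfc : ContinuousOn f {0}ᶜ) :
    ContinuousAt f 0 := by
  obtain ⟨C, hC⟩ := isCompact_unitCircle.exists_bound_of_continuousOn
    (hfc.mono fun u hu => ne_zero_of_mem_unitCircle hu)
  rw [continuousAt_iff_punctured_nhds, hf.apply_zero hn, Metric.tendsto_nhds]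
  intro ε hε
  have hsmall : ∀ᶠ ρ in 𝓝 (0 : ℝ), ρ ^ n * C < ε :=
    ((continuous_pow n).mul continuous_const).continuousAt.eventually_lt_const (by simpa [hn])
  obtain ⟨r, hr, hball⟩ := Metric.eventually_nhds_iff.1 hsmall
  refine eventually_nhdsNE_zero_of_forall_parabolicDilation hr fun ρ hρ u hu => ?_
  have hρn : 0 < ρ ^ n := pow_pos hρ.1 n
  rw [hf ρ hρ.1, dist_zero_right, norm_mul, Real.norm_of_nonneg hρn.le]
  refine (mul_le_mul_of_nonneg_left (hC u hu) hρn.le).trans_lt (hball ?_)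
  rw [dist_zero_right, Real.norm_of_nonneg hρ.1.le]
  exact hρ.2

theorem eventually_sum_pos {f : ℕ → ℝ × ℝ → ℝ} {n N K : ℕ}
    (hf : ∀ k, IsParabolicHomogeneous (f k) (n + k)) (hfc : ∀ k, ContinuousOn (f k) {0}ᶜ)
    (hzero : ∀ k < N, ∀ z ≠ 0, f k z = 0) (hpos : ∀ z ≠ 0, 0 < f N z) (hNK : N < K) :
    ∀ᶠ z in 𝓝[≠] 0, 0 < ∑ k ∈ Finset.range K, f k z := by
  obtain ⟨m, rfl⟩ := Nat.exists_eq_add_of_lt hNK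
  have hblowup : ∀ ρ > 0, ∀ u ∈ unitCircle,
      ∑ k ∈ Finset.range (N + m + 1), f k (parabolicDilation ρ u) =
        ρ ^ (n + N) * ∑ k ∈ Finset.range (m + 1), ρ ^ k * f (N + k) u := by
    intro ρ hρ u hu
    rw [add_assoc, Finset.sum_range_add, Finset.sum_eq_zero fun k hk => hzero k
      (Finset.mem_range.1 hk) _ (parabolicDilation_ne_zero hρ (ne_zero_of_mem_unitCircle hu)),
      zero_add, Finset.mul_sum]
    refine Finset.sum_congr rfl fun k _ => ?_
    rw [hf _ ρ hρ]
    ring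
  have hnear : ∀ᶠ ρ in 𝓝 (0 : ℝ), ∀ u ∈ unitCircle,
      0 < ∑ k ∈ Finset.range (m + 1), ρ ^ k * f (N + k) u := by
    refine isCompact_unitCircle.eventually_forall_of_forall_eventually fun u hu => ?_
    have hu0 := ne_zero_of_mem_unitCircle hu
    have hcont : ContinuousAt
        (fun p : ℝ × (ℝ × ℝ) => ∑ k ∈ Finset.range (m + 1), p.1 ^ k * f (N + k) p.2) (0, u) := by
      refine tendsto_finsetSum _ fun k _ => (continuousAt_fst.pow k).mul ?_
      exact ((hfc (N + k)).continuousAt (isOpen_compl_singleton.mem_nhds hu0)).comp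
        (f := Prod.snd) continuousAt_snd
    exact hcont.eventually_const_lt (by simpa [Finset.sum_range_succ'] using hpos u hu0)
  obtain ⟨r, hr, hball⟩ := Metric.eventually_nhds_iff.1 hnear
  refine eventually_nhdsNE_zero_of_forall_parabolicDilation hr fun ρ hρ u hu => ?_
  rw [hblowup ρ hρ.1 u hu]
  refine mul_pos (pow_pos hρ.1 _) (hball ?_ u hu)
  rw [dist_zero_right, Real.norm_of_nonneg hρ.1.le]
  exact hρ.2

/-- An expansion of the vector field `X` into finitely many quasi-homogeneous vector fields `P i`
of the degrees `d + i`. -/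
structure IsParabolicExpansion (X : ℝ × ℝ → ℝ × ℝ) (P : ℕ → ℝ × ℝ → ℝ × ℝ) (d M : ℕ) : Prop where
  homogeneous : ∀ i, IsParabolicHomogeneousField (P i) (d + i)
  contDiff : ∀ i, ContDiff ℝ 1 (P i)
  eq_zero : ∀ i ≥ M, P i = 0
  sum_eq : X = ∑ i ∈ Finset.range M, P i

theorem sum_range_diag_eq_sum_sum {R : Type*} [AddCommMonoid R] {a : ℕ → ℕ → R} {M m K : ℕ}
    (hM : ∀ i ≥ M, ∀ j, a i j = 0) (hm : ∀ i, ∀ j ≥ m, a i j = 0) (hK : M + m ≤ K) :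
    ∑ k ∈ Finset.range K, ∑ i ∈ Finset.range (k + 1), a i (k - i) =
      ∑ i ∈ Finset.range M, ∑ j ∈ Finset.range m, a i j := by
  rw [Finset.sum_range_diag_flip, Finset.eventually_constant_sum
    (fun i hi => Finset.sum_eq_zero fun j _ => hM i hi j) (by omega : M ≤ K)]
  refine Finset.sum_congr rfl fun i hi => Finset.eventually_constant_sum (hm i) ?_
  have := Finset.mem_range.1 hi
  omega

theorem differentiableAt_of_contDiffOn_compl {E F : Type*} [NormedAddCommGroup E]
    [NormedSpace ℝ E] [NormedAddCommGroup F] [NormedSpace ℝ F] {f : E → F} {p z : E}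
    (hf : ContDiffOn ℝ 1 f {p}ᶜ) (hz : z ≠ p) : DifferentiableAt ℝ f z :=
  (hf.contDiffAt (isOpen_compl_singleton.mem_nhds hz)).differentiableAt one_ne_zero

theorem IsParabolicExpansion.lieDeriv_sum {X : ℝ × ℝ → ℝ × ℝ} {P : ℕ → ℝ × ℝ → ℝ × ℝ}
    {d M : ℕ} (hX : IsParabolicExpansion X P d M) {ι : Type*} {s : Finset ι}
    {V : ι → ℝ × ℝ → ℝ} {z : ℝ × ℝ} (hV : ∀ j ∈ s, DifferentiableAt ℝ (V j) z) :
    lieDeriv X (fun z => ∑ j ∈ s, V j z) z =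
      ∑ i ∈ Finset.range M, ∑ j ∈ s, lieDeriv (P i) (V j) z := by
  simp only [lieDeriv, fderiv_fun_sum hV, hX.sum_eq, Finset.sum_apply, map_sum,
    sum_apply]

theorem IsParabolicExpansion.homogeneous_lieDeriv {X : ℝ × ℝ → ℝ × ℝ} {P : ℕ → ℝ × ℝ → ℝ × ℝ}
    {d M n : ℕ} (hX : IsParabolicExpansion X P d M) {V : ℕ → ℝ × ℝ → ℝ}
    (hV : ∀ j, IsParabolicHomogeneous (V j) (n + j)) (σ : ℝ) (k : ℕ) :
    IsParabolicHomogeneous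
      (fun z => σ * ∑ i ∈ Finset.range (k + 1), lieDeriv (P i) (V (k - i)) z) (n + d + k) := by
  intro ρ hρ z
  simp only [Finset.mul_sum]
  refine Finset.sum_congr rfl fun i hi => ?_
  have hik : n + (k - i) + (d + i) = n + d + k := by
    have := Finset.mem_range.1 hi
    omega
  rw [isParabolicHomogeneous_lieDeriv (hV (k - i)) (hX.homogeneous i) ρ hρ z, hik]
  ring

theorem IsParabolicExpansion.continuousOn_lieDeriv {X : ℝ × ℝ → ℝ × ℝ} {P : ℕ → ℝ × ℝ → ℝ × ℝ}
    {d M : ℕ} (hX : IsParabolicExpansion X P d M) {V : ℕ → ℝ × ℝ → ℝ}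
    (hV : ∀ j, ContDiffOn ℝ 1 (V j) {0}ᶜ) (σ : ℝ) (k : ℕ) :
    ContinuousOn
      (fun z => σ * ∑ i ∈ Finset.range (k + 1), lieDeriv (P i) (V (k - i)) z) {0}ᶜ := by
  refine continuousOn_const.mul (continuousOn_finsetSum _ fun i _ => ?_)
  exact ((hV _).continuousOn_fderiv_of_isOpen isOpen_compl_singleton le_rfl).clm_apply
    (hX.contDiff i).continuous.continuousOn

/-- The Lie derivative of `∑ V j` along `∑ P i` has the quasi-homogeneous components
`∑ i ≤ k, lieDeriv (P i) (V (k - i))`. If the first of them which does not vanish has a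
sign, then `∑ V j` is a strict Lyapunov function for one of the two directions of time. -/
theorem not_isCenter_of_homologicalEquations {X : ℝ × ℝ → ℝ × ℝ} {P : ℕ → ℝ × ℝ → ℝ × ℝ}
    {V : ℕ → ℝ × ℝ → ℝ} {d M n m N : ℕ} {σ : ℝ} (hX : IsParabolicExpansion X P d M) (hn : n ≠ 0)
    (hV : ∀ j, IsParabolicHomogeneous (V j) (n + j)) (hVd : ∀ j, ContDiffOn ℝ 1 (V j) {0}ᶜ)
    (hVm : ∀ j ≥ m, V j = 0) (hV0 : ∀ z ≠ 0, 0 < V 0 z)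
    (hzero : ∀ k < N, ∀ z ≠ 0, ∑ i ∈ Finset.range (k + 1), lieDeriv (P i) (V (k - i)) z = 0)
    (hpos : ∀ z ≠ 0, 0 < σ * ∑ i ∈ Finset.range (N + 1), lieDeriv (P i) (V (N - i)) z) :
    ¬IsCenter X 0 := by
  have hσ : σ ≠ 0 := by
    rintro rfl
    simpa using hpos 1 one_ne_zero
  set S : ℝ × ℝ → ℝ := fun z => ∑ j ∈ Finset.range (m + 1), V j z
  set W : ℕ → ℝ × ℝ → ℝ := fun k z => ∑ i ∈ Finset.range (k + 1), lieDeriv (P i) (V (k - i)) z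
  have hlie : ∀ z ≠ 0, lieDeriv X S z = ∑ k ∈ Finset.range (M + (m + 1) + N + 1), W k z := by
    intro z hz
    rw [hX.lieDeriv_sum fun j _ => differentiableAt_of_contDiffOn_compl (hVd j) hz]
    refine (sum_range_diag_eq_sum_sum (fun i hi j => ?_) (fun i j hj => ?_) (by omega)).symm
    · simp [lieDeriv, hX.eq_zero i hi]
    · simp [lieDeriv, hVm j (by omega)]
  have hVpos : ∀ᶠ z in 𝓝[≠] 0, 0 < S z :=
    eventually_sum_pos (N := 0) hV (fun j => (hVd j).continuousOn) (by simp) hV0 (by simp)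
  have hWpos : ∀ᶠ z in 𝓝[≠] 0, 0 < ∑ k ∈ Finset.range (M + (m + 1) + N + 1), σ * W k z :=
    eventually_sum_pos (hX.homogeneous_lieDeriv hV σ) (hX.continuousOn_lieDeriv hVd σ)
      (fun k hk z hz => mul_eq_zero_of_right σ (hzero k hk z hz)) hpos (by omega)
  refine fun hc => not_isCenter_of_strictLyapunov (V := S) ?_ ?_ ?_
    (hc.const_smul (neg_ne_zero.2 hσ))
  · exact Finset.sum_eq_zero fun j _ => (hV j).apply_zero (by omega)
  · exact tendsto_finsetSum _ fun j _ => (hV j).continuousAt_zero (by omega) (hVd j).continuousOn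
  · filter_upwards [hVpos, hWpos, self_mem_nhdsWithin] with z hVz hWz hz
    refine ⟨hVz, ?_, ?_⟩
    · exact DifferentiableAt.fun_sum fun j _ => differentiableAt_of_contDiffOn_compl (hVd j) hz
    · have hsmul : lieDeriv (-σ • X) S z = -(σ * lieDeriv X S z) := by simp [lieDeriv]
      rwa [hsmul, neg_lt_zero, hlie z hz, Finset.mul_sum]

/-- The quasi-homogeneous components, of degrees `1, 2, 3, 4`, of the cubic field. -/
def cubicPart (A B K L : ℝ) : ℕ → ℝ × ℝ → ℝ × ℝ
  | 0, z => (z.2, -z.1 ^ 3)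
  | 1, z => (A * z.1 * z.2, 0)
  | 2, z => (B * z.2 ^ 2, K * z.1 * z.2 ^ 2)
  | 3, z => (0, L * z.2 ^ 3)
  | _, _ => 0

theorem isParabolicExpansion_cubicField (A B K L : ℝ) :
    IsParabolicExpansion (cubicField A B K L) (cubicPart A B K L) 1 4 where
  homogeneous
    | 0, ρ, _, z => by ext <;> simp [cubicPart, parabolicDilation] <;> ring
    | 1, ρ, _, z => by ext <;> simp [cubicPart, parabolicDilation]; ring
    | 2, ρ, _, z => by ext <;> simp [cubicPart, parabolicDilation] <;> ring
    | 3, ρ, _, z => by ext <;> simp [cubicPart, parabolicDilation]; ring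
    | _ + 4, ρ, _, z => by ext <;> simp [cubicPart, parabolicDilation]
  contDiff
    | 0 => by change ContDiff ℝ 1 fun z : ℝ × ℝ => (z.2, -z.1 ^ 3); fun_prop
    | 1 => by change ContDiff ℝ 1 fun z : ℝ × ℝ => (A * z.1 * z.2, (0 : ℝ)); fun_prop
    | 2 => by change ContDiff ℝ 1 fun z : ℝ × ℝ => (B * z.2 ^ 2, K * z.1 * z.2 ^ 2); fun_prop
    | 3 => by change ContDiff ℝ 1 fun z : ℝ × ℝ => ((0 : ℝ), L * z.2 ^ 3); fun_prop
    | _ + 4 => contDiff_const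
  eq_zero
    | _ + 4, _ => rfl
  sum_eq := by
    ext z <;> simp [cubicField, cubicPart, Finset.sum_range_succ]

/-- The Hamiltonian of the leading part `(y, -x ^ 3)` of the cubic field. -/
noncomputable def quarticHamiltonian (z : ℝ × ℝ) : ℝ :=
  z.2 ^ 2 / 2 + z.1 ^ 4 / 4

/-- A quasi-homogeneous function of degree `0` whose derivative along `(y, -x ^ 3)` is `x`. It is
needed because `x` is not the derivative of a polynomial. -/
noncomputable def parabolicAngle (z : ℝ × ℝ) : ℝ :=
  -Complex.arg ⟨z.1 ^ 2, √2 * z.2⟩ / √2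

theorem quarticHamiltonian_pos {z : ℝ × ℝ} (hz : z ≠ 0) : 0 < quarticHamiltonian z := by
  unfold quarticHamiltonian
  by_cases hx : z.1 = 0
  · have hy : z.2 ≠ 0 := fun hy => hz (Prod.ext hx hy)
    positivity
  · positivity

theorem isParabolicHomogeneous_quarticHamiltonian :
    IsParabolicHomogeneous quarticHamiltonian 4 := by
  intro ρ _ z
  simp only [quarticHamiltonian, parabolicDilation]
  ring

theorem contDiff_quarticHamiltonian {n : WithTop ℕ∞} : ContDiff ℝ n quarticHamiltonian := by
  unfold quarticHamiltonian
  fun_prop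

theorem lieDeriv_quarticHamiltonian (X : ℝ × ℝ → ℝ × ℝ) (z : ℝ × ℝ) :
    lieDeriv X quarticHamiltonian z = z.2 * (X z).2 + z.1 ^ 3 * (X z).1 := by
  unfold lieDeriv quarticHamiltonian
  simp (disch := fun_prop) [fderiv_fun_add, div_eq_mul_inv, fderiv_mul_const, fderiv_fun_pow,
    fderiv_fst, fderiv_snd]
  ring

theorem isParabolicHomogeneous_parabolicAngle : IsParabolicHomogeneous parabolicAngle 0 := by
  intro ρ hρ z
  have hmul : (⟨(ρ * z.1) ^ 2, √2 * (ρ ^ 2 * z.2)⟩ : ℂ) =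
      ((ρ ^ 2 : ℝ) : ℂ) * ⟨z.1 ^ 2, √2 * z.2⟩ := by
    apply Complex.ext
    · simp only [Complex.re_ofReal_mul]
      ring
    · simp only [Complex.im_ofReal_mul]
      ring
  simp only [parabolicAngle, parabolicDilation]
  rw [hmul, Complex.arg_real_mul _ (pow_pos hρ 2), pow_zero, one_mul]

theorem parabolicAngle_mem_slitPlane {z : ℝ × ℝ} (hz : z ≠ 0) :
    (⟨z.1 ^ 2, √2 * z.2⟩ : ℂ) ∈ Complex.slitPlane := by
  rw [Complex.mem_slitPlane_iff]
  by_cases hx : z.1 = 0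
  · have hy : z.2 ≠ 0 := fun hy => hz (Prod.ext hx hy)
    exact Or.inr (mul_ne_zero (by positivity) hy)
  · exact Or.inl (by positivity)

theorem parabolicAngle_eq_log : parabolicAngle = fun z => (-Complex.imCLM ∘ Complex.log ∘
    Complex.equivRealProdCLM.symm ∘ fun w => (w.1 ^ 2, √2 * w.2)) z * (√2)⁻¹ :=
  funext fun _ => congrArg (fun a => -a * (√2)⁻¹) (Complex.log_im _).symm

theorem contDiffOn_parabolicAngle {n : WithTop ℕ∞} : ContDiffOn ℝ n parabolicAngle {0}ᶜ := by
  intro z hz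
  have hpair : ContDiffAt ℝ n
      (Complex.equivRealProdCLM.symm ∘ fun w : ℝ × ℝ => (w.1 ^ 2, √2 * w.2)) z := by fun_prop
  have hlog := ((Complex.contDiffAt_log (parabolicAngle_mem_slitPlane hz)).restrict_scalars ℝ).comp
    z hpair
  rw [parabolicAngle_eq_log]
  exact ((Complex.imCLM.contDiff.contDiffAt.comp z hlog).neg.mul contDiffAt_const).contDiffWithinAt

theorem lieDeriv_parabolicAngle (X : ℝ × ℝ → ℝ × ℝ) {z : ℝ × ℝ} (hz : z ≠ 0) :
    lieDeriv X parabolicAngle z =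
      z.1 * (2 * z.2 * (X z).1 - z.1 * (X z).2) / (4 * quarticHamiltonian z) := by
  have hpair := Complex.equivRealProdCLM.symm.hasFDerivAt.comp z
    (((hasFDerivAt_fst (𝕜 := ℝ) (p := z)).pow 2).prodMk (hasFDerivAt_snd.const_mul (√2)))
  have hlog := (Complex.hasStrictDerivAt_log
    (parabolicAngle_mem_slitPlane hz)).complexToReal_fderiv.hasFDerivAt.comp z hpair
  have hangle := (Complex.imCLM.hasFDerivAt.comp z hlog).neg.mul_const (√2)⁻¹
  have hnorm : Complex.normSq ⟨z.1 ^ 2, √2 * z.2⟩ = 4 * quarticHamiltonian z := by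
    rw [Complex.normSq_mk, quarticHamiltonian]
    linear_combination z.2 ^ 2 * Real.sq_sqrt zero_le_two
  rw [lieDeriv, parabolicAngle_eq_log, hangle.fderiv, ← hnorm]
  simp only [Nat.add_one_sub_one, pow_one, nsmul_eq_mul, Nat.cast_ofNat,
    ContinuousLinearMap.smul_comp, smul_neg, neg_apply, smul_apply,
    ContinuousLinearMap.comp_apply, ContinuousLinearMap.prod_apply, ContinuousLinearMap.coe_fst',
    smul_eq_mul, ContinuousLinearMap.coe_snd', ContinuousLinearEquiv.coe_coe,
    one_apply_eq_self, Complex.imCLM_apply, Complex.mul_im, Complex.inv_re,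
    Complex.normSq_mk, Complex.equivRealProdCLM_symm_apply_im, Complex.inv_im,
    Complex.equivRealProdCLM_symm_apply_re]
  field_simp
  ring

/-- The quasi-homogeneous components, of degrees `4, …, 9`, of a Lyapunov function of the cubic
field, obtained by solving the homological equations degree by degree. Only the last component
involves a square root: no multiple of `x y H` has a derivative of the right sign. -/
noncomputable def lyapunovPart (A B K L : ℝ) : ℕ → ℝ × ℝ → ℝ
  | 0, z => quarticHamiltonian z
  | 1, z => -A / 5 * z.1 ^ 5
  | 2, z => B / 3 * z.2 ^ 3 - K / 2 * z.1 ^ 2 * z.2 ^ 2 + (A ^ 2 - K) / 6 * z.1 ^ 6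
  | 3, z => -(A * B / 9 + 2 * L / 3) * z.1 * z.2 ^ 3 + A * K / 3 * z.1 ^ 3 * z.2 ^ 2 +
      (A * B / 9 - L / 3) * z.1 ^ 5 * z.2 + (5 * A * K / 21 - A ^ 3 / 7) * z.1 ^ 7
  | 4, z => (11 / 48 * A ^ 2 * B - B * K / 8) * z.1 ^ 2 * z.2 ^ 3 +
      (K ^ 2 - A ^ 2 * K) / 4 * z.1 ^ 4 * z.2 ^ 2 -
      B * (A ^ 2 - 2 * K) / 32 * z.1 ^ 6 * z.2 +
      (A ^ 4 / 8 - 13 / 48 * A ^ 2 * K + K ^ 2 / 16) * z.1 ^ 8 -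
      B * (A ^ 2 - 2 * K) / 2 * quarticHamiltonian z ^ 2 * parabolicAngle z
  | 5, z => (59 / 405 * A * B * K - 52 / 405 * A ^ 3 * B) * z.1 ^ 3 * z.2 ^ 3 +
      (A ^ 3 * K / 5 - A * K ^ 2 / 3) * z.1 ^ 5 * z.2 ^ 2 +
      11 / 108 * A * B * (A ^ 2 - 2 * K) * z.1 ^ 7 * z.2 +
      (77 / 270 * A ^ 3 * K - A ^ 5 / 9 - 7 / 54 * A * K ^ 2) * z.1 ^ 9 +
      A * B * (A ^ 2 - 2 * K) / 5 * z.1 ^ 5 * quarticHamiltonian z * parabolicAngle z -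
      7 / 135 * A * B * (A ^ 2 - 2 * K) * z.1 * z.2 *
        (quarticHamiltonian z * √(quarticHamiltonian z))
  | _, _ => 0

theorem isParabolicHomogeneous_lyapunovPart (A B K L : ℝ) (j : ℕ) :
    IsParabolicHomogeneous (lyapunovPart A B K L j) (4 + j) := by
  intro ρ hρ z
  have hH := isParabolicHomogeneous_quarticHamiltonian ρ hρ z
  have hφ := isParabolicHomogeneous_parabolicAngle ρ hρ z
  have hsqrt : √(quarticHamiltonian (parabolicDilation ρ z)) = ρ ^ 2 * √(quarticHamiltonian z) := by
    rw [hH, Real.sqrt_mul' _ (by unfold quarticHamiltonian; positivity),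
      show ρ ^ 4 = (ρ ^ 2) ^ 2 by ring, Real.sqrt_sq (by positivity)]
  match j with
  | 0 => exact hH
  | 1 | 2 | 3 => simp only [lyapunovPart, parabolicDilation]; ring
  | 4 =>
    simp only [lyapunovPart, hH, hφ]
    simp only [parabolicDilation]
    ring
  | 5 =>
    simp only [lyapunovPart, hsqrt]
    simp only [hH, hφ]
    simp only [parabolicDilation]
    ring
  | _ + 6 => simp only [lyapunovPart, mul_zero]

theorem contDiffOn_lyapunovPart (A B K L : ℝ) (j : ℕ) :
    ContDiffOn ℝ 1 (lyapunovPart A B K L j) {0}ᶜ := by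
  have hH : ContDiffOn ℝ 1 quarticHamiltonian {0}ᶜ := contDiff_quarticHamiltonian.contDiffOn
  have hφ : ContDiffOn ℝ 1 parabolicAngle {0}ᶜ := contDiffOn_parabolicAngle
  have hsqrt : ContDiffOn ℝ 1 (fun z => √(quarticHamiltonian z)) {0}ᶜ :=
    hH.sqrt fun z hz => (quarticHamiltonian_pos hz).ne'
  match j with
  | 0 => exact hH
  | 1 | 2 | 3 | 4 | 5 => unfold lyapunovPart; fun_prop
  | _ + 6 => exact contDiffOn_const

theorem lieDeriv_lyapunovPart_one (A B K L : ℝ) (X : ℝ × ℝ → ℝ × ℝ) (z : ℝ × ℝ) :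
    lieDeriv X (lyapunovPart A B K L 1) z = -A * z.1 ^ 4 * (X z).1 := by
  unfold lieDeriv lyapunovPart
  simp (disch := fun_prop) only [fderiv_const_mul, fderiv_fun_pow, Nat.add_one_sub_one,
    nsmul_eq_mul, Nat.cast_ofNat, fderiv_fst, smul_apply, ContinuousLinearMap.coe_fst',
    smul_eq_mul, neg_mul]
  ring

theorem lieDeriv_lyapunovPart_two (A B K L : ℝ) (X : ℝ × ℝ → ℝ × ℝ) (z : ℝ × ℝ) :
    lieDeriv X (lyapunovPart A B K L 2) z =
      ((A ^ 2 - K) * z.1 ^ 5 - K * z.1 * z.2 ^ 2) * (X z).1 +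
        (B * z.2 ^ 2 - K * z.1 ^ 2 * z.2) * (X z).2 := by
  unfold lieDeriv lyapunovPart
  simp (disch := fun_prop) only [fderiv_fun_add, fderiv_fun_sub, fderiv_fun_mul, fderiv_fun_pow,
    Nat.add_one_sub_one, nsmul_eq_mul, Nat.cast_ofNat, fderiv_snd, fderiv_fun_const,
    Pi.zero_apply, smul_zero, add_zero, pow_one, fderiv_fst, add_apply, sub_apply, smul_apply,
    ContinuousLinearMap.coe_snd', smul_eq_mul, ContinuousLinearMap.coe_fst']
  ring

theorem lieDeriv_lyapunovPart_three (A B K L : ℝ) (X : ℝ × ℝ → ℝ × ℝ) (z : ℝ × ℝ) :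
    lieDeriv X (lyapunovPart A B K L 3) z =
      (-(A * B / 9 + 2 * L / 3) * z.2 ^ 3 + A * K * z.1 ^ 2 * z.2 ^ 2 +
        5 * (A * B / 9 - L / 3) * z.1 ^ 4 * z.2 +
        7 * (5 * A * K / 21 - A ^ 3 / 7) * z.1 ^ 6) * (X z).1 +
      (-(A * B / 3 + 2 * L) * z.1 * z.2 ^ 2 + 2 * A * K / 3 * z.1 ^ 3 * z.2 +
        (A * B / 9 - L / 3) * z.1 ^ 5) * (X z).2 := by
  unfold lieDeriv lyapunovPart
  simp (disch := fun_prop) only [neg_add_rev, fderiv_fun_add, fderiv_fun_mul, fderiv_fun_pow,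
    Nat.add_one_sub_one, nsmul_eq_mul, Nat.cast_ofNat, fderiv_snd, fderiv_fst,
    fderiv_fun_neg, fderiv_fun_const, Pi.zero_apply, neg_zero, smul_zero, add_zero, pow_one,
    fderiv_fun_sub, sub_self, add_apply, smul_apply, ContinuousLinearMap.coe_snd', smul_eq_mul,
    ContinuousLinearMap.coe_fst']
  ring

theorem lieDeriv_lyapunovPart_four (A B K L : ℝ) (X : ℝ × ℝ → ℝ × ℝ) {z : ℝ × ℝ} (hz : z ≠ 0) :
    lieDeriv X (lyapunovPart A B K L 4) z =
      (2 * (11 / 48 * A ^ 2 * B - B * K / 8) * z.1 * z.2 ^ 3 +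
        (K ^ 2 - A ^ 2 * K) * z.1 ^ 3 * z.2 ^ 2 -
        3 * B * (A ^ 2 - 2 * K) / 16 * z.1 ^ 5 * z.2 +
        8 * (A ^ 4 / 8 - 13 / 48 * A ^ 2 * K + K ^ 2 / 16) * z.1 ^ 7) * (X z).1 +
      (3 * (11 / 48 * A ^ 2 * B - B * K / 8) * z.1 ^ 2 * z.2 ^ 2 +
        (K ^ 2 - A ^ 2 * K) / 2 * z.1 ^ 4 * z.2 -
        B * (A ^ 2 - 2 * K) / 32 * z.1 ^ 6) * (X z).2 -
      B * (A ^ 2 - 2 * K) / 2 * (quarticHamiltonian z ^ 2 * lieDeriv X parabolicAngle z +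
        2 * quarticHamiltonian z * parabolicAngle z * lieDeriv X quarticHamiltonian z) := by
  have hH : DifferentiableAt ℝ quarticHamiltonian z :=
    contDiff_quarticHamiltonian.differentiable one_ne_zero z
  have hφ : DifferentiableAt ℝ parabolicAngle z :=
    differentiableAt_of_contDiffOn_compl contDiffOn_parabolicAngle hz
  unfold lieDeriv lyapunovPart
  simp (disch := fun_prop) only [fderiv_fun_sub, fderiv_fun_add, fderiv_fun_mul, fderiv_fun_pow,
    Nat.add_one_sub_one, nsmul_eq_mul, Nat.cast_ofNat, fderiv_snd, pow_one, fderiv_fst,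
    fderiv_fun_const, Pi.zero_apply, smul_zero, add_zero, sub_self, sub_apply,
    add_apply, smul_apply, ContinuousLinearMap.coe_snd', smul_eq_mul,
    ContinuousLinearMap.coe_fst']
  ring

theorem lieDeriv_lyapunovPart_five (A B K L : ℝ) (X : ℝ × ℝ → ℝ × ℝ) {z : ℝ × ℝ} (hz : z ≠ 0) :
    lieDeriv X (lyapunovPart A B K L 5) z =
      (3 * (59 / 405 * A * B * K - 52 / 405 * A ^ 3 * B) * z.1 ^ 2 * z.2 ^ 3 +
        5 * (A ^ 3 * K / 5 - A * K ^ 2 / 3) * z.1 ^ 4 * z.2 ^ 2 +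
        77 / 108 * A * B * (A ^ 2 - 2 * K) * z.1 ^ 6 * z.2 +
        9 * (77 / 270 * A ^ 3 * K - A ^ 5 / 9 - 7 / 54 * A * K ^ 2) * z.1 ^ 8) * (X z).1 +
      (3 * (59 / 405 * A * B * K - 52 / 405 * A ^ 3 * B) * z.1 ^ 3 * z.2 ^ 2 +
        2 * (A ^ 3 * K / 5 - A * K ^ 2 / 3) * z.1 ^ 5 * z.2 +
        11 / 108 * A * B * (A ^ 2 - 2 * K) * z.1 ^ 7) * (X z).2 +
      A * B * (A ^ 2 - 2 * K) / 5 * (5 * z.1 ^ 4 * (X z).1 * quarticHamiltonian z *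
          parabolicAngle z + z.1 ^ 5 * parabolicAngle z * lieDeriv X quarticHamiltonian z +
        z.1 ^ 5 * quarticHamiltonian z * lieDeriv X parabolicAngle z) -
      7 / 135 * A * B * (A ^ 2 - 2 * K) * √(quarticHamiltonian z) *
        ((z.2 * (X z).1 + z.1 * (X z).2) * quarticHamiltonian z +
          3 / 2 * z.1 * z.2 * lieDeriv X quarticHamiltonian z) := by
  have hHpos := quarticHamiltonian_pos hz
  have hH : DifferentiableAt ℝ quarticHamiltonian z :=
    contDiff_quarticHamiltonian.differentiable one_ne_zero z
  have hφ : DifferentiableAt ℝ parabolicAngle z :=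
    differentiableAt_of_contDiffOn_compl contDiffOn_parabolicAngle hz
  have hsqrt : DifferentiableAt ℝ (fun w => √(quarticHamiltonian w)) z := hH.sqrt hHpos.ne'
  have hdiv : quarticHamiltonian z / √(quarticHamiltonian z) = √(quarticHamiltonian z) :=
    Real.div_sqrt
  unfold lieDeriv lyapunovPart
  simp (disch := fun_prop) only [fderiv_fun_sub, fderiv_fun_add, fderiv_fun_mul, fderiv_fun_pow,
    Nat.add_one_sub_one, nsmul_eq_mul, Nat.cast_ofNat, fderiv_snd, fderiv_fst, fderiv_fun_const,
    Pi.zero_apply, smul_zero, add_zero, sub_self, pow_one, smul_add, fderiv_sqrt hH hHpos.ne',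
    one_div, mul_inv_rev, sub_apply, add_apply, smul_apply, ContinuousLinearMap.coe_snd',
    smul_eq_mul, ContinuousLinearMap.coe_fst']
  linear_combination -(7 / 270) * A * B * (A ^ 2 - 2 * K) * z.1 * z.2 *
    fderiv ℝ quarticHamiltonian z (X z) * hdiv

theorem lieDeriv_lyapunovPart_zero (A B K L : ℝ) (X : ℝ × ℝ → ℝ × ℝ) (z : ℝ × ℝ) :
    lieDeriv X (lyapunovPart A B K L 0) z = z.2 * (X z).2 + z.1 ^ 3 * (X z).1 :=
  lieDeriv_quarticHamiltonian X z

theorem lieDeriv_cubicPart_of_four_le (A B K L : ℝ) {i : ℕ} (hi : 4 ≤ i) (f : ℝ × ℝ → ℝ)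
    (z : ℝ × ℝ) : lieDeriv (cubicPart A B K L i) f z = 0 := by
  rw [(isParabolicExpansion_cubicField A B K L).eq_zero i hi]
  exact map_zero _

/-- The quasi-homogeneous form of degree `8` by which the first focal value is multiplied in the
derivative of the Lyapunov function. -/
def firstFocalForm (z : ℝ × ℝ) : ℝ :=
  z.1 ^ 8 + z.1 ^ 4 * z.2 ^ 2 + z.2 ^ 4

/-- The quasi-homogeneous function of degree `10` by which the second focal value is multiplied in
the derivative of the Lyapunov function. -/
noncomputable def secondFocalForm (z : ℝ × ℝ) : ℝ :=
  z.1 ^ 10 + z.1 ^ 6 * z.2 ^ 2 + z.1 ^ 2 * z.2 ^ 4 +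
    (z.2 ^ 2 - z.1 ^ 4) * (quarticHamiltonian z * √(quarticHamiltonian z))

theorem firstFocalForm_pos {z : ℝ × ℝ} (hz : z ≠ 0) : 0 < firstFocalForm z := by
  unfold firstFocalForm
  by_cases hx : z.1 = 0
  · have hy : z.2 ≠ 0 := fun hy => hz (Prod.ext hx hy)
    positivity
  · positivity

theorem secondFocalForm_pos {z : ℝ × ℝ} (hz : z ≠ 0) : 0 < secondFocalForm z := by
  have hH := quarticHamiltonian_pos hz
  have hg : 0 < quarticHamiltonian z * √(quarticHamiltonian z) := mul_pos hH (Real.sqrt_pos.2 hH)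
  rw [secondFocalForm]
  rcases le_or_gt (z.1 ^ 4) (z.2 ^ 2) with hle | hlt
  · by_cases hx : z.1 = 0
    · have hy : z.2 ≠ 0 := fun hy => hz (Prod.ext hx hy)
      rw [hx]
      ring_nf
      positivity
    · exact add_pos_of_pos_of_nonneg (by positivity) (mul_nonneg (sub_nonneg.2 hle) hg.le)
  · have hx : z.1 ≠ 0 := by
      intro hx
      rw [hx] at hlt
      nlinarith [sq_nonneg z.2]
    have hH34 : quarticHamiltonian z ≤ 3 / 4 * z.1 ^ 4 := by
      unfold quarticHamiltonian
      linarith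
    have hsqrt : √(quarticHamiltonian z) ≤ z.1 ^ 2 :=
      Real.sqrt_le_iff.2 ⟨sq_nonneg _, by nlinarith [sq_nonneg (z.1 ^ 2)]⟩
    have hg34 : quarticHamiltonian z * √(quarticHamiltonian z) ≤ 3 / 4 * z.1 ^ 4 * z.1 ^ 2 := by
      gcongr
    have hterm := mul_le_mul_of_nonneg_left hg34 (sub_nonneg.2 hlt.le)
    have h10 : 0 < z.1 ^ 10 := by positivity
    have h62 : 0 ≤ z.1 ^ 6 * z.2 ^ 2 := by positivity
    have h24 : 0 ≤ z.1 ^ 2 * z.2 ^ 4 := by positivity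
    linarith

theorem sum_lieDeriv_lyapunovPart_of_lt_three (A B K L : ℝ) {k : ℕ} (hk : k < 3) (z : ℝ × ℝ) :
    ∑ i ∈ Finset.range (k + 1), lieDeriv (cubicPart A B K L i) (lyapunovPart A B K L (k - i)) z =
      0 := by
  interval_cases k <;>
    simp only [zero_add, Finset.range_one, zero_tsub, lieDeriv_lyapunovPart_zero, cubicPart,
      Finset.sum_singleton, mul_neg, Nat.reduceAdd, Finset.sum_range_succ, tsub_zero,
      lieDeriv_lyapunovPart_one, neg_mul, tsub_self, mul_zero, lieDeriv_lyapunovPart_two,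
      Nat.add_one_sub_one] <;>
    ring

theorem sum_lieDeriv_lyapunovPart_three (A B K L : ℝ) (z : ℝ × ℝ) :
    ∑ i ∈ Finset.range 4, lieDeriv (cubicPart A B K L i) (lyapunovPart A B K L (3 - i)) z =
      (L / 3 - A * B / 9) * firstFocalForm z := by
  simp only [Finset.sum_range_succ, Finset.range_one, Finset.sum_singleton, tsub_zero,
    lieDeriv_lyapunovPart_three, neg_add_rev, cubicPart, mul_neg, Nat.add_one_sub_one,
    lieDeriv_lyapunovPart_two, mul_zero, add_zero, Nat.reduceSub, lieDeriv_lyapunovPart_one,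
    neg_mul, tsub_self, lieDeriv_lyapunovPart_zero, firstFocalForm]
  ring

theorem sum_lieDeriv_lyapunovPart_four {A B K L : ℝ} (hL : A * B = 3 * L) {z : ℝ × ℝ}
    (hz : z ≠ 0) :
    ∑ i ∈ Finset.range 5, lieDeriv (cubicPart A B K L i) (lyapunovPart A B K L (4 - i)) z = 0 := by
  obtain rfl : L = A * B / 3 := by linarith
  simp only [Finset.sum_range_succ, Finset.range_one, Finset.sum_singleton, tsub_zero,
    lieDeriv_lyapunovPart_four _ _ _ _ _ hz, cubicPart, mul_neg, lieDeriv_parabolicAngle _ hz,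
    sub_neg_eq_add, lieDeriv_quarticHamiltonian, Nat.add_one_sub_one,
    lieDeriv_lyapunovPart_three, neg_add_rev, mul_zero, add_zero, Nat.reduceSub,
    lieDeriv_lyapunovPart_two, lieDeriv_lyapunovPart_one, neg_mul, tsub_self, Std.le_refl,
    lieDeriv_cubicPart_of_four_le]
  field_simp
  rw [quarticHamiltonian]
  ring

theorem sum_lieDeriv_lyapunovPart_five {A B K L : ℝ} (hL : A * B = 3 * L) {z : ℝ × ℝ}
    (hz : z ≠ 0) :
    ∑ i ∈ Finset.range 6, lieDeriv (cubicPart A B K L i) (lyapunovPart A B K L (5 - i)) z =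
      -(7 / 135) * (A * B * (A ^ 2 - 2 * K)) * secondFocalForm z := by
  have hH := (quarticHamiltonian_pos hz).ne'
  obtain rfl : L = A * B / 3 := by linarith
  simp only [Finset.sum_range_succ, Finset.range_one, Finset.sum_singleton, tsub_zero,
    lieDeriv_lyapunovPart_five _ _ _ _ _ hz, cubicPart, mul_neg, lieDeriv_quarticHamiltonian,
    lieDeriv_parabolicAngle _ hz, sub_neg_eq_add, Nat.add_one_sub_one,
    lieDeriv_lyapunovPart_four _ _ _ _ _ hz, mul_zero, add_zero, zero_add, Nat.reduceSub,
    lieDeriv_lyapunovPart_three, neg_add_rev, lieDeriv_lyapunovPart_two,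
    lieDeriv_lyapunovPart_one, neg_mul, Prod.fst_zero, tsub_self, Nat.reduceLeDiff,
    lieDeriv_cubicPart_of_four_le]
  field_simp
  rw [secondFocalForm, quarticHamiltonian]
  ring

theorem not_isCenter_cubicField_of_sum_lieDeriv {A B K L σ : ℝ} {N : ℕ}
    (hzero : ∀ k < N, ∀ z ≠ 0, ∑ i ∈ Finset.range (k + 1),
      lieDeriv (cubicPart A B K L i) (lyapunovPart A B K L (k - i)) z = 0)
    (hpos : ∀ z ≠ 0, 0 < σ * ∑ i ∈ Finset.range (N + 1),
      lieDeriv (cubicPart A B K L i) (lyapunovPart A B K L (N - i)) z) :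
    ¬IsCenter (cubicField A B K L) 0 :=
  not_isCenter_of_homologicalEquations (m := 6) (isParabolicExpansion_cubicField A B K L)
    four_ne_zero (isParabolicHomogeneous_lyapunovPart A B K L) (contDiffOn_lyapunovPart A B K L)
    (fun | _ + 6, _ => rfl) (fun _ => quarticHamiltonian_pos) hzero hpos

theorem mul_eq_three_mul_of_isCenter_cubicField {A B K L : ℝ}
    (h : IsCenter (cubicField A B K L) 0) : A * B = 3 * L := by
  by_contra hne
  have hfocal : L / 3 - A * B / 9 ≠ 0 := fun h0 => hne (by linarith)
  refine not_isCenter_cubicField_of_sum_lieDeriv (σ := L / 3 - A * B / 9) (N := 3)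
    (fun k hk z _ => sum_lieDeriv_lyapunovPart_of_lt_three A B K L hk z) (fun z hz => ?_) h
  rw [sum_lieDeriv_lyapunovPart_three, ← mul_assoc]
  exact mul_pos (mul_self_pos.2 hfocal) (firstFocalForm_pos hz)

theorem mul_mul_sub_eq_zero_of_isCenter_cubicField {A B K L : ℝ}
    (h : IsCenter (cubicField A B K L) 0) : A * B * (A ^ 2 - 2 * K) = 0 := by
  have hL := mul_eq_three_mul_of_isCenter_cubicField h
  by_contra hne
  have hzero : ∀ k < 5, ∀ z ≠ 0, ∑ i ∈ Finset.range (k + 1),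
      lieDeriv (cubicPart A B K L i) (lyapunovPart A B K L (k - i)) z = 0 := by
    intro k hk z hz
    obtain hk3 | rfl | rfl : k < 3 ∨ k = 3 ∨ k = 4 := by omega
    · exact sum_lieDeriv_lyapunovPart_of_lt_three A B K L hk3 z
    · rw [sum_lieDeriv_lyapunovPart_three]
      exact mul_eq_zero_of_left (by linarith) _
    · exact sum_lieDeriv_lyapunovPart_four hL hz
  refine not_isCenter_cubicField_of_sum_lieDeriv (σ := -(7 / 135) * (A * B * (A ^ 2 - 2 * K)))
    hzero (fun z hz => ?_) h
  rw [sum_lieDeriv_lyapunovPart_five hL hz, ← mul_assoc]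
  exact mul_pos (mul_self_pos.2 (mul_ne_zero (by norm_num) hne)) (secondFocalForm_pos hz)

theorem isPicardLindelof_of_lipschitz_of_bounded {E : Type*} [NormedAddCommGroup E]
    {v : ℝ → E → E} {C M : NNReal} (hv : ∀ t, LipschitzWith C (v t))
    (hc : ∀ x, Continuous fun t => v t x) (hM : ∀ t x, ‖v t x‖ ≤ M) (t₀ : ℝ) (x₀ : E) (l : NNReal) :
    IsPicardLindelof v (tmin := t₀ - l) (tmax := t₀ + l)
      ⟨t₀, sub_le_self t₀ l.2, le_add_of_nonneg_right l.2⟩ x₀ (M * l) 0 M C where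
  lipschitzOnWith t _ := (hv t).lipschitzOnWith
  continuousOn x _ := (hc x).continuousOn
  norm_le t _ x _ := hM t x
  mul_max_le := by
    simp only [add_sub_cancel_left, sub_sub_cancel, max_self, NNReal.coe_zero, sub_zero,
      NNReal.coe_mul, le_refl]

theorem exists_forall_hasDerivAt_of_lipschitz_of_bounded {E : Type*} [NormedAddCommGroup E]
    [NormedSpace ℝ E] [CompleteSpace E] {v : ℝ → E → E} {C M : NNReal}
    (hv : ∀ t, LipschitzWith C (v t)) (hc : ∀ x, Continuous fun t => v t x)
    (hM : ∀ t x, ‖v t x‖ ≤ M) (t₀ : ℝ) (x₀ : E) :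
    ∃ α : ℝ → E, α t₀ = x₀ ∧ ∀ t, HasDerivAt α (v t (α t)) t := by
  have hlocal : ∀ n : ℕ, ∃ α : ℝ → E, α t₀ = x₀ ∧
      ∀ t ∈ Metric.ball t₀ n, HasDerivAt α (v t (α t)) t := by
    intro n
    obtain ⟨α, h0, hα⟩ := (isPicardLindelof_of_lipschitz_of_bounded hv hc hM t₀ x₀
      n).exists_eq_forall_mem_Icc_hasDerivWithinAt₀
    refine ⟨α, h0, fun t ht => ?_⟩
    rw [Real.ball_eq_Ioo] at ht
    exact (hα t (Set.Ioo_subset_Icc_self ht)).hasDerivAt (Icc_mem_nhds ht.1 ht.2)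
  choose α h0 hα using hlocal
  have hagree : ∀ m n : ℕ, m ≤ n → Set.EqOn (α m) (α n) (Metric.ball t₀ m) := by
    intro m n hmn t ht
    have hsub : Metric.ball t₀ (m : ℝ) ⊆ Metric.ball t₀ n :=
      Metric.ball_subset_ball (Nat.cast_le.2 hmn)
    have hm : t₀ ∈ Metric.ball t₀ (m : ℝ) := Metric.mem_ball_self (dist_nonneg.trans_lt ht)
    simp only [Real.ball_eq_Ioo] at hm ht hsub hα
    exact ODE_solution_unique_of_mem_Ioo (s := fun _ => Set.univ)
      (fun s _ => (hv s).lipschitzOnWith) hm (fun s hs => ⟨hα m s hs, trivial⟩)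
      (fun s hs => ⟨hα n s (hsub hs), trivial⟩) ((h0 m).trans (h0 n).symm) ht
  set k : ℝ → ℕ := fun t => ⌊dist t t₀⌋₊ + 1
  have hk : ∀ t, t ∈ Metric.ball t₀ (k t : ℝ) := fun t => by
    simpa [k] using Nat.lt_floor_add_one (dist t t₀)
  have hglue : ∀ (n : ℕ), ∀ t ∈ Metric.ball t₀ (n : ℝ), α (k t) t = α n t := fun n t ht =>
    (le_total (k t) n).elim (fun h => hagree _ _ h (hk t)) fun h => (hagree _ _ h ht).symm
  refine ⟨fun t => α (k t) t, h0 _, fun t => (hα _ t (hk t)).congr_of_eventuallyEq ?_⟩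
  filter_upwards [Metric.isOpen_ball.mem_nhds (hk t)] with u hu using hglue _ u hu

theorem periodic_of_hasDerivAt_of_eq {E : Type*} [NormedAddCommGroup E] [NormedSpace ℝ E]
    {v : ℝ → E → E} {C : NNReal} {T : ℝ} (hv : ∀ t, LipschitzWith C (v t))
    (hT : ∀ t x, v (t + T) x = v t x) {α : ℝ → E} (hα : ∀ t, HasDerivAt α (v t (α t)) t) {b : ℝ}
    (hb : α (b + T) = α b) : Function.Periodic α T := by
  have hshift : ∀ t, HasDerivAt (fun t => α (t + T)) (v t (α (t + T))) t := fun t => by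
    simpa only [hT] using (hα (t + T)).comp_add_const t T
  exact congrFun (ODE_solution_unique_univ (s := fun _ => Set.univ) (t₀ := b)
    (fun t => (hv t).lipschitzOnWith) (fun t => ⟨hshift t, trivial⟩) (fun t => ⟨hα t, trivial⟩) hb)

theorem eq_reflect_of_hasDerivAt {E : Type*} [NormedAddCommGroup E] [NormedSpace ℝ E]
    {v : ℝ → E → E} {C : NNReal} {a : ℝ} (hv : ∀ t, LipschitzWith C (v t))
    (ha : ∀ t x, v (2 * a - t) x = -v t x) {α : ℝ → E}
    (hα : ∀ t, HasDerivAt α (v t (α t)) t) (t : ℝ) : α (2 * a - t) = α t := by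
  have hreflect : ∀ t, HasDerivAt (fun t => α (2 * a - t)) (v t (α (2 * a - t))) t := fun t => by
    simpa only [ha, neg_neg] using (hα (2 * a - t)).comp_const_sub (2 * a) t
  exact congrFun (ODE_solution_unique_univ (s := fun _ => Set.univ) (t₀ := a)
    (fun t => (hv t).lipschitzOnWith) (fun t => ⟨hreflect t, trivial⟩)
    (fun t => ⟨hα t, trivial⟩) (by ring_nf)) t

theorem periodic_of_hasDerivAt_of_reflect {E : Type*} [NormedAddCommGroup E] [NormedSpace ℝ E]
    {v : ℝ → E → E} {C : NNReal} {a T : ℝ} (hv : ∀ t, LipschitzWith C (v t))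
    (hT : ∀ t x, v (t + T) x = v t x) (ha : ∀ t x, v (2 * a - t) x = -v t x) {α : ℝ → E}
    (hα : ∀ t, HasDerivAt α (v t (α t)) t) : Function.Periodic α T := by
  refine periodic_of_hasDerivAt_of_eq hv hT hα (b := a - T / 2) ?_
  rw [← eq_reflect_of_hasDerivAt hv ha hα (a - T / 2)]
  ring_nf

theorem exists_reparametrization {w : ℝ → ℝ} {P : ℝ} (hw : Continuous w) (hpos : ∀ θ, 0 < w θ)
    (hP : 0 < P) (hper : Function.Periodic w P) (a : ℝ) :
    ∃ (Θ : ℝ → ℝ) (T : ℝ), Θ 0 = a ∧ 0 < T ∧ (∀ t, HasDerivAt Θ (w (Θ t))⁻¹ t) ∧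
      (∀ t, Θ (t + T) = Θ t + P) ∧ Function.Surjective Θ := by
  set τ : ℝ → ℝ := fun θ => ∫ u in a..θ, w u
  have hint : ∀ b c, IntervalIntegrable w MeasureTheory.volume b c := hw.intervalIntegrable
  have hτ : ∀ θ, HasDerivAt τ (w θ) θ := fun θ => (hw.integral_hasStrictDerivAt a θ).hasDerivAt
  have hτa : τ a = 0 := intervalIntegral.integral_same
  have hmono : StrictMono τ := strictMono_of_deriv_pos fun θ => (hτ θ).deriv ▸ hpos θ
  have hτP : ∀ θ, τ (θ + P) = τ θ + τ (a + P) := fun θ => by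
    simp only [τ, ← intervalIntegral.integral_add_adjacent_intervals (hint a θ) (hint θ (θ + P)),
      hper.intervalIntegral_add_eq θ a]
  have hsurj : Function.Surjective τ := by
    have hcont : Continuous τ := continuous_iff_continuousAt.2 fun θ => (hτ θ).continuousAt
    have hsplit : τ = fun θ => τ 0 + ∫ u in 0..θ, w u := funext fun θ =>
      (intervalIntegral.integral_add_adjacent_intervals (hint a 0) (hint 0 θ)).symm
    refine hcont.surjective ?_ ?_ <;> rw [hsplit]
    · exact Filter.tendsto_atTop_add_const_left _ _
        (hper.tendsto_atTop_intervalIntegral_of_pos' (hint 0 P) hpos hP)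
    · exact Filter.tendsto_atBot_add_const_left _ _
        (hper.tendsto_atBot_intervalIntegral_of_pos' (hint 0 P) hpos hP)
  set e : ℝ ≃o ℝ := hmono.orderIsoOfSurjective τ hsurj
  refine ⟨e.symm, τ (a + P), e.symm_apply_eq.2 hτa.symm, hτa ▸ hmono (lt_add_of_pos_right a hP),
    fun t => ?_, fun t => ?_, e.symm.surjective⟩
  · exact HasDerivAt.of_local_left_inverse e.symm.continuous.continuousAt (hτ _) (hpos _).ne'
      (Filter.Eventually.of_forall e.apply_symm_apply)
  · rw [e.symm_apply_eq]
    exact (congrArg (· + τ (a + P)) (e.apply_symm_apply t).symm).trans (hτP _).symm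

/-- The angular speed of the vector field `X` in the polar coordinates `z = (ρ cos θ, ρ ² sin θ)`,
up to the positive factor `ρ ^ 3 * (1 + sin θ ^ 2)`. -/
def angularSpeed (X : ℝ × ℝ → ℝ × ℝ) (z : ℝ × ℝ) : ℝ :=
  z.1 * (X z).2 - 2 * z.2 * (X z).1

/-- The slope `d (log ρ) / dθ` of the orbits of `X` at the point `parabolicDilation ρ u` with
`u = (cos θ, sin θ)`. -/
noncomputable def polarSlope (X : ℝ × ℝ → ℝ × ℝ) (ρ : ℝ) (u : ℝ × ℝ) : ℝ :=
  ρ * (u.1 * (ρ * (X (parabolicDilation ρ u)).1) + u.2 * (X (parabolicDilation ρ u)).2) /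
    angularSpeed X (parabolicDilation ρ u)

/-- The right-hand side of the differential equation `dr / dθ` of the orbits of `X` in the
coordinates `r = log ρ` and `θ`, frozen beyond `r = r₀` so that it can be globally Lipschitz. -/
noncomputable def truncatedSlope (X : ℝ × ℝ → ℝ × ℝ) (r₀ θ r : ℝ) : ℝ :=
  polarSlope X (Real.exp (min r r₀)) (Real.cos θ, Real.sin θ)

/-- The origin is a monodromic singular point of `X`: for `ρ ≤ exp r₀` the orbits turn clockwise,
with a slope which is Lipschitz in `log ρ` and bounded. -/
structure IsMonodromic (X : ℝ × ℝ → ℝ × ℝ) (r₀ : ℝ) (C M : NNReal) : Prop where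
  apply_zero : X 0 = 0
  continuous : Continuous X
  angularSpeed_neg : ∀ ρ ∈ Set.Ioc 0 (Real.exp r₀), ∀ u ∈ unitCircle,
    angularSpeed X (parabolicDilation ρ u) < 0
  lipschitzWith : ∀ θ, LipschitzWith C (truncatedSlope X r₀ θ)
  norm_le : ∀ θ r, ‖truncatedSlope X r₀ θ r‖ ≤ M

/-- The curve with equation `log ρ = α θ` in polar coordinates. -/
noncomputable def polarCurve (α : ℝ → ℝ) (θ : ℝ) : ℝ × ℝ :=
  parabolicDilation (Real.exp (α θ)) (Real.cos θ, Real.sin θ)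

theorem truncatedSlope_add_two_pi (X : ℝ × ℝ → ℝ × ℝ) (r₀ θ r : ℝ) :
    truncatedSlope X r₀ (θ + 2 * Real.pi) r = truncatedSlope X r₀ θ r := by
  rw [truncatedSlope, Real.cos_add_two_pi, Real.sin_add_two_pi, truncatedSlope]

theorem abs_exp_min_sub_le (r₀ a b : ℝ) :
    |Real.exp (min a r₀) - Real.exp (min b r₀)| ≤ Real.exp r₀ * |a - b| := by
  have hexp : |Real.exp (min a r₀) - Real.exp (min b r₀)| ≤
      Real.exp r₀ * |min a r₀ - min b r₀| :=
    (convex_Iic r₀).norm_image_sub_le_of_norm_deriv_le (f := Real.exp)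
      (fun x _ => Real.differentiableAt_exp)
      (fun x hx => by
        rw [Real.deriv_exp, Real.norm_eq_abs, Real.abs_exp]
        exact Real.exp_le_exp.2 hx) (min_le_right b r₀) (min_le_right a r₀)
  refine hexp.trans (mul_le_mul_of_nonneg_left ?_ (Real.exp_pos r₀).le)
  simpa only [sub_self, abs_zero, abs_nonneg, max_eq_left] using abs_min_sub_min_le_max a r₀ b r₀

section BlowUp

variable {X : ℝ × ℝ → ℝ × ℝ} {Y : ℝ → ℝ × ℝ → ℝ × ℝ} {d : ℕ}

theorem angularSpeed_parabolicDilation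
    (hY : ∀ ρ > 0, ∀ u, X (parabolicDilation ρ u) = ρ ^ d • parabolicDilation ρ (Y ρ u))
    {ρ : ℝ} (hρ : 0 < ρ) (u : ℝ × ℝ) :
    angularSpeed X (parabolicDilation ρ u) = ρ ^ (d + 3) * angularSpeed (Y ρ) u := by
  rw [angularSpeed, hY ρ hρ, angularSpeed]
  simp only [parabolicDilation, Prod.smul_fst, Prod.smul_snd, smul_eq_mul]
  ring

theorem polarSlope_eq_polarSlope_one
    (hY : ∀ ρ > 0, ∀ u, X (parabolicDilation ρ u) = ρ ^ d • parabolicDilation ρ (Y ρ u))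
    {ρ : ℝ} (hρ : 0 < ρ) (u : ℝ × ℝ) : polarSlope X ρ u = polarSlope (Y ρ) 1 u := by
  rw [polarSlope, angularSpeed_parabolicDilation hY hρ, hY ρ hρ, polarSlope,
    show parabolicDilation 1 u = u by simp [parabolicDilation]]
  refine Eq.trans ?_ (mul_div_mul_left _ _ (pow_ne_zero (d + 3) hρ.ne'))
  congr 1
  simp only [parabolicDilation, Prod.smul_fst, Prod.smul_snd, smul_eq_mul]
  ring

theorem contDiffAt_polarSlope_one (hYc : ContDiff ℝ 1 fun p : ℝ × (ℝ × ℝ) => Y p.1 p.2)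
    {p : ℝ × (ℝ × ℝ)} (hp : angularSpeed (Y p.1) p.2 ≠ 0) :
    ContDiffAt ℝ 1 (fun p : ℝ × (ℝ × ℝ) => polarSlope (Y p.1) 1 p.2) p := by
  have hYp := hYc.contDiffAt (x := p)
  simp only [polarSlope, parabolicDilation, one_pow, one_mul, angularSpeed] at hp ⊢
  exact ContDiffAt.div (by fun_prop) (by fun_prop) hp

theorem exists_forall_angularSpeed_neg (hYc : Continuous fun p : ℝ × (ℝ × ℝ) => Y p.1 p.2)
    (hneg : ∀ u ∈ unitCircle, angularSpeed (Y 0) u < 0) :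
    ∃ r₀, ∀ ρ ∈ Set.Icc 0 (Real.exp r₀), ∀ u ∈ unitCircle, angularSpeed (Y ρ) u < 0 := by
  have hcont : Continuous fun p : ℝ × (ℝ × ℝ) => angularSpeed (Y p.1) p.2 := by
    unfold angularSpeed
    fun_prop
  have hnear : ∀ᶠ ρ in 𝓝 (0 : ℝ), ∀ u ∈ unitCircle, angularSpeed (Y ρ) u < 0 :=
    isCompact_unitCircle.eventually_forall_of_forall_eventually fun u hu =>
      hcont.continuousAt.eventually_lt_const (hneg u hu)
  obtain ⟨ε, hε, hball⟩ := Metric.eventually_nhds_iff.1 hnear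
  refine ⟨Real.log (ε / 2), fun ρ hρ => hball ?_⟩
  rw [Real.exp_log (half_pos hε)] at hρ
  rw [dist_zero_right, Real.norm_of_nonneg hρ.1]
  exact hρ.2.trans_lt (half_lt_self hε)

/-- After the blow-up `z = parabolicDilation ρ u`, the vector field extends to `ρ = 0`; it is
monodromic when the extension turns clockwise along the exceptional divisor `ρ = 0`. -/
theorem exists_isMonodromic (hX0 : X 0 = 0) (hXc : Continuous X)
    (hY : ∀ ρ > 0, ∀ u, X (parabolicDilation ρ u) = ρ ^ d • parabolicDilation ρ (Y ρ u))
    (hYc : ContDiff ℝ 1 fun p : ℝ × (ℝ × ℝ) => Y p.1 p.2)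
    (hneg : ∀ u ∈ unitCircle, angularSpeed (Y 0) u < 0) : ∃ r₀ C M, IsMonodromic X r₀ C M := by
  obtain ⟨r₀, hr₀⟩ := exists_forall_angularSpeed_neg hYc.continuous hneg
  set S : Set (ℝ × (ℝ × ℝ)) := Set.Icc 0 (Real.exp r₀) ×ˢ unitCircle
  set F : ℝ × (ℝ × ℝ) → ℝ := fun p => polarSlope (Y p.1) 1 p.2
  have hS : IsCompact S := isCompact_Icc.prod isCompact_unitCircle
  have hF : ∀ p ∈ S, ContDiffAt ℝ 1 F p := fun p hp =>
    contDiffAt_polarSlope_one hYc (hr₀ p.1 hp.1 p.2 hp.2).ne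
  obtain ⟨C, hC⟩ : ∃ C, LipschitzOnWith C F S := by
    refine LocallyLipschitzOn.exists_lipschitzOnWith_of_compact hS fun p hp => ?_
    obtain ⟨C, t, ht, h⟩ := (hF p hp).exists_lipschitzOnWith
    exact ⟨C, t, mem_nhdsWithin_of_mem_nhds ht, h⟩
  obtain ⟨M, hM⟩ := hS.exists_bound_of_continuousOn fun p hp =>
    (hF p hp).continuousAt.continuousWithinAt
  have hmem : ∀ θ r, (Real.exp (min r r₀), Real.cos θ, Real.sin θ) ∈ S := fun θ r =>
    ⟨⟨(Real.exp_pos _).le, Real.exp_le_exp.2 (min_le_right r r₀)⟩, cos_sin_mem_unitCircle θ⟩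
  have hslope : ∀ θ r, truncatedSlope X r₀ θ r = F (Real.exp (min r r₀), Real.cos θ, Real.sin θ) :=
    fun θ r => polarSlope_eq_polarSlope_one hY (Real.exp_pos _) _
  refine ⟨r₀, C * (Real.exp r₀).toNNReal, M.toNNReal, hX0, hXc, fun ρ hρ u hu => ?_, fun θ => ?_,
    fun θ r => ?_⟩
  · rw [angularSpeed_parabolicDilation hY hρ.1]
    exact mul_neg_of_pos_of_neg (pow_pos hρ.1 _) (hr₀ ρ ⟨hρ.1.le, hρ.2⟩ u hu)
  · refine LipschitzWith.of_dist_le_mul fun a b => ?_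
    rw [hslope, hslope, NNReal.coe_mul, Real.coe_toNNReal _ (Real.exp_pos r₀).le, mul_assoc]
    refine (hC.dist_le_mul _ (hmem θ a) _ (hmem θ b)).trans ?_
    rw [Prod.dist_eq, dist_self, max_eq_left dist_nonneg]
    exact mul_le_mul_of_nonneg_left (abs_exp_min_sub_le r₀ a b) C.2
  · rw [hslope]
    exact (hM _ (hmem θ r)).trans (Real.le_coe_toNNReal M)

end BlowUp

theorem continuous_polarCurve {α : ℝ → ℝ} (hα : Continuous α) : Continuous (polarCurve α) := by
  unfold polarCurve parabolicDilation
  fun_prop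

theorem polarCurve_periodic {α : ℝ → ℝ} (hα : Function.Periodic α (2 * Real.pi)) :
    Function.Periodic (polarCurve α) (2 * Real.pi) := fun θ => by
  rw [polarCurve, hα, Real.cos_add_two_pi, Real.sin_add_two_pi, polarCurve]

theorem polarCurve_ne_zero (α : ℝ → ℝ) (θ : ℝ) : polarCurve α θ ≠ 0 :=
  parabolicDilation_ne_zero (Real.exp_pos _) (ne_zero_of_mem_unitCircle (cos_sin_mem_unitCircle θ))

theorem polarCurve_add_pi_ne (α : ℝ → ℝ) (θ : ℝ) : polarCurve α (θ + Real.pi) ≠ polarCurve α θ := by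
  intro h
  simp only [polarCurve, parabolicDilation, Real.cos_add_pi, Real.sin_add_pi, Prod.mk.injEq] at h
  have hcos : (Real.exp (α (θ + Real.pi)) + Real.exp (α θ)) * Real.cos θ = 0 := by
    linear_combination -h.1
  have hsin : (Real.exp (α (θ + Real.pi)) ^ 2 + Real.exp (α θ) ^ 2) * Real.sin θ = 0 := by
    linear_combination -h.2
  refine ne_zero_of_mem_unitCircle (cos_sin_mem_unitCircle θ) (Prod.ext ?_ ?_)
  · exact (mul_eq_zero.1 hcos).resolve_left (by positivity)
  · exact (mul_eq_zero.1 hsin).resolve_left (by positivity)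

theorem hasDerivAt_polarCurve {X : ℝ × ℝ → ℝ × ℝ} {α : ℝ → ℝ} {θ : ℝ}
    (hα : HasDerivAt α (polarSlope X (Real.exp (α θ)) (Real.cos θ, Real.sin θ)) θ)
    (hne : angularSpeed X (polarCurve α θ) ≠ 0) :
    HasDerivAt (polarCurve α) ((Real.exp (α θ) ^ 3 * (1 + Real.sin θ ^ 2) /
      angularSpeed X (polarCurve α θ)) • X (polarCurve α θ)) θ := by
  have hfst := hα.exp.mul (Real.hasDerivAt_cos θ)
  have hsnd := (hα.exp.pow 2).mul (Real.hasDerivAt_sin θ)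
  refine (hfst.prodMk hsnd).congr_deriv ?_
  have hsin : 1 + Real.sin θ ^ 2 = Real.cos θ ^ 2 + 2 * Real.sin θ ^ 2 := by
    linear_combination -Real.cos_sq_add_sin_sq θ
  rw [polarSlope, ← polarCurve, hsin]
  ext <;> simp only [Pi.pow_apply, Prod.smul_fst, Prod.smul_snd, smul_eq_mul, Nat.cast_ofNat] <;>
    field_simp <;> simp only [angularSpeed, polarCurve, parabolicDilation] <;> ring

/-- The function `μ` is an integrating factor of the vector field `X`, with first integral `H`:
`dH = μ * (X.1 * dy - X.2 * dx)`. -/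
def HasIntegratingFactor (X : ℝ × ℝ → ℝ × ℝ) (μ H : ℝ × ℝ → ℝ) : Prop :=
  ∀ z, HasFDerivAt H
    (μ z • ((X z).1 • ContinuousLinearMap.snd ℝ ℝ ℝ - (X z).2 • ContinuousLinearMap.fst ℝ ℝ ℝ)) z

theorem HasIntegratingFactor.hasDerivAt_parabolicDilation {X : ℝ × ℝ → ℝ × ℝ} {H μ : ℝ × ℝ → ℝ}
    (hH : HasIntegratingFactor X μ H) {ρ : ℝ} (hρ : ρ ≠ 0) (u : ℝ × ℝ) :
    HasDerivAt (fun ρ => H (parabolicDilation ρ u))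
      (-(μ (parabolicDilation ρ u) * angularSpeed X (parabolicDilation ρ u) / ρ)) ρ := by
  have hray : HasDerivAt (fun ρ => parabolicDilation ρ u) (u.1, 2 * ρ * u.2) ρ := by
    simpa [parabolicDilation] using ((hasDerivAt_id ρ).mul_const u.1).prodMk
      ((hasDerivAt_pow 2 ρ).mul_const u.2)
  refine ((hH _).comp_hasDerivAt ρ hray).congr_deriv ?_
  simp only [smul_apply, sub_apply,
    ContinuousLinearMap.coe_fst', ContinuousLinearMap.coe_snd', smul_eq_mul, angularSpeed]
  field_simp
  simp only [parabolicDilation]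
  ring

namespace IsMonodromic

variable {X : ℝ × ℝ → ℝ × ℝ} {r₀ : ℝ} {C M : NNReal} {α : ℝ → ℝ}
  {H μ : ℝ × ℝ → ℝ}

theorem angularSpeed_polarCurve_neg (hX : IsMonodromic X r₀ C M) {θ : ℝ} (hθ : α θ ≤ r₀) :
    angularSpeed X (polarCurve α θ) < 0 :=
  hX.angularSpeed_neg _ ⟨Real.exp_pos _, Real.exp_le_exp.2 hθ⟩ _ (cos_sin_mem_unitCircle θ)

theorem hasDerivAt_polarCurve (hX : IsMonodromic X r₀ C M) {θ : ℝ} (hθ : α θ ≤ r₀)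
    (hα : HasDerivAt α (truncatedSlope X r₀ θ (α θ)) θ) :
    HasDerivAt (polarCurve α) ((Real.exp (α θ) ^ 3 * (1 + Real.sin θ ^ 2) /
      angularSpeed X (polarCurve α θ)) • X (polarCurve α θ)) θ := by
  rw [truncatedSlope, min_eq_left hθ] at hα
  exact _root_.hasDerivAt_polarCurve hα (hX.angularSpeed_polarCurve_neg hθ).ne

theorem continuous_truncatedSlope (hX : IsMonodromic X r₀ C M) (r : ℝ) :
    Continuous fun θ => truncatedSlope X r₀ θ r := by
  have hne : ∀ θ, angularSpeed X
      (parabolicDilation (Real.exp (min r r₀)) (Real.cos θ, Real.sin θ)) ≠ 0 := fun θ =>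
    (hX.angularSpeed_neg _ ⟨Real.exp_pos _, Real.exp_le_exp.2 (min_le_right r r₀)⟩ _
      (cos_sin_mem_unitCircle θ)).ne
  have hXc := hX.continuous
  simp only [truncatedSlope, polarSlope]
  refine Continuous.div ?_ ?_ hne
  · unfold parabolicDilation
    fun_prop
  · unfold angularSpeed parabolicDilation
    fun_prop

theorem le_of_mem_Icc (hX : IsMonodromic X r₀ C M)
    (hα : ∀ θ, HasDerivAt α (truncatedSlope X r₀ θ (α θ)) θ) {a : ℝ}
    (ha : α a ≤ r₀ - M * (2 * Real.pi)) {θ : ℝ} (hθ : θ ∈ Set.Icc a (a + 2 * Real.pi)) :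
    α θ ≤ r₀ := by
  have hlip : |α θ - α a| ≤ M * |θ - a| :=
    convex_univ.norm_image_sub_le_of_norm_hasDerivWithin_le (fun x _ => (hα x).hasDerivWithinAt)
      (fun x _ => hX.norm_le _ _) (Set.mem_univ a) (Set.mem_univ θ)
  have hangle : M * |θ - a| ≤ M * (2 * Real.pi) := by
    rw [abs_of_nonneg (sub_nonneg.2 hθ.1)]
    exact mul_le_mul_of_nonneg_left (sub_le_iff_le_add'.2 hθ.2) M.2
  linarith [le_abs_self (α θ - α a)]

theorem exists_periodic_orbit (hX : IsMonodromic X r₀ C M)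
    (hα : ∀ θ, HasDerivAt α (truncatedSlope X r₀ θ (α θ)) θ) (hle : ∀ θ, α θ ≤ r₀)
    (hper : Function.Periodic α (2 * Real.pi)) (a : ℝ) :
    ∃ (γ : ℝ → ℝ × ℝ) (T : ℝ), γ 0 = polarCurve α a ∧ (∀ t, HasDerivAt γ (X (γ t)) t) ∧
      (∀ t, γ t ≠ 0) ∧ 0 < T ∧ Function.Periodic γ T ∧ ∀ s, ∃ t, γ t ≠ γ s := by
  have hXc := hX.continuous
  have hαc : Continuous α := continuous_iff_continuousAt.2 fun θ => (hα θ).continuousAt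
  have hcurve := polarCurve_periodic hper
  have hneg : ∀ θ, angularSpeed X (polarCurve α θ) < 0 := fun θ =>
    hX.angularSpeed_polarCurve_neg (hle θ)
  set w : ℝ → ℝ := fun θ =>
    -(Real.exp (α θ) ^ 3 * (1 + Real.sin θ ^ 2) / angularSpeed X (polarCurve α θ))
  have hw : Continuous w := by
    have hspeed : Continuous (angularSpeed X) := by
      unfold angularSpeed
      fun_prop
    exact (Continuous.div (by fun_prop) (hspeed.comp (continuous_polarCurve hαc))
      fun θ => (hneg θ).ne).neg
  have hwpos : ∀ θ, 0 < w θ := fun θ => neg_pos.2 (div_neg_of_pos_of_neg (by positivity) (hneg θ))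
  have hwper : Function.Periodic w (2 * Real.pi) := fun θ => by
    simp only [w, hper θ, hcurve θ, Real.sin_add_two_pi]
  obtain ⟨Θ, T, hΘ0, hT, hΘ, hΘT, hΘs⟩ :=
    exists_reparametrization hw hwpos Real.two_pi_pos hwper a
  refine ⟨fun t => polarCurve α (Θ (-t)), T, by simp only [neg_zero, hΘ0], fun t => ?_,
    fun t => polarCurve_ne_zero _ _, hT, fun t => ?_, fun s => ?_⟩
  · have hrev : HasDerivAt (fun u => Θ (-u)) (-(w (Θ (-t)))⁻¹) t := by
      simpa using (hΘ (0 - t)).comp_const_sub 0 t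
    refine ((hX.hasDerivAt_polarCurve (hle _) (hα _)).scomp t hrev).congr_deriv ?_
    rw [smul_smul, ← inv_neg, neg_neg, inv_mul_cancel₀ (neg_ne_zero.1 (hwpos _).ne'), one_smul]
  · have hturn : Θ (-t) = Θ (-(t + T)) + 2 * Real.pi := by
      rw [← hΘT, neg_add_rev, neg_add_cancel_comm]
    simp only [hturn, hcurve (Θ (-(t + T)))]
  · obtain ⟨u, hu⟩ := hΘs (Θ (-s) + Real.pi)
    exact ⟨-u, by simpa only [neg_neg, hu] using polarCurve_add_pi_ne α (Θ (-s))⟩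

theorem isCenter_of_return (hX : IsMonodromic X r₀ C M)
    (hreturn : ∀ α : ℝ → ℝ, (∀ θ, HasDerivAt α (truncatedSlope X r₀ θ (α θ)) θ) → ∀ a,
      (∀ θ ∈ Set.Icc a (a + 2 * Real.pi), α θ ≤ r₀) → α (a + 2 * Real.pi) = α a) :
    IsCenter X 0 := by
  refine isCenter_of_eventually_periodic hX.apply_zero
    (eventually_nhdsNE_zero_of_forall_parabolicDilation
      (Real.exp_pos (r₀ - M * (2 * Real.pi))) fun ρ hρ u hu => ?_)
  obtain ⟨a, rfl⟩ := exists_eq_cos_sin_of_mem_unitCircle hu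
  obtain ⟨α, hαa, hα⟩ := exists_forall_hasDerivAt_of_lipschitz_of_bounded hX.lipschitzWith
    hX.continuous_truncatedSlope hX.norm_le a (Real.log ρ)
  have hle : ∀ θ ∈ Set.Icc a (a + 2 * Real.pi), α θ ≤ r₀ := fun θ =>
    hX.le_of_mem_Icc hα (hαa ▸ (Real.log_le_iff_le_exp hρ.1).2 hρ.2.le)
  have hper : Function.Periodic α (2 * Real.pi) := periodic_of_hasDerivAt_of_eq hX.lipschitzWith
    (truncatedSlope_add_two_pi X r₀) hα (hreturn α hα a hle)
  have hle' : ∀ θ, α θ ≤ r₀ := fun θ => by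
    obtain ⟨θ', hθ', h⟩ := hper.exists_mem_Ico Real.two_pi_pos θ a
    exact h ▸ hle θ' (Set.Ico_subset_Icc_self hθ')
  have hpoint : polarCurve α a = parabolicDilation ρ (Real.cos a, Real.sin a) := by
    rw [polarCurve, hαa, Real.exp_log hρ.1]
  exact hpoint ▸ hX.exists_periodic_orbit hα hle' hper a

theorem isCenter_of_reflect (hX : IsMonodromic X r₀ C M) {a : ℝ}
    (ha : ∀ θ r, truncatedSlope X r₀ (2 * a - θ) r = -truncatedSlope X r₀ θ r) :
    IsCenter X 0 :=
  hX.isCenter_of_return fun _ hα b _ => periodic_of_hasDerivAt_of_reflect hX.lipschitzWith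
    (truncatedSlope_add_two_pi X r₀) ha hα b

theorem isCenter_of_reversible_neg_snd (hX : IsMonodromic X r₀ C M)
    (hrev : ∀ x y, X (x, -y) = (-(X (x, y)).1, (X (x, y)).2)) : IsCenter X 0 := by
  refine hX.isCenter_of_reflect (a := 0) fun θ r => ?_
  rw [mul_zero, zero_sub, truncatedSlope, Real.cos_neg, Real.sin_neg, truncatedSlope]
  simp only [polarSlope, angularSpeed, parabolicDilation, mul_neg, hrev, ← neg_div]
  ring_nf

theorem isCenter_of_reversible_neg_fst (hX : IsMonodromic X r₀ C M)
    (hrev : ∀ x y, X (-x, y) = ((X (x, y)).1, -(X (x, y)).2)) : IsCenter X 0 := by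
  refine hX.isCenter_of_reflect (a := Real.pi / 2) fun θ r => ?_
  rw [mul_div_cancel₀ _ two_ne_zero, truncatedSlope, Real.cos_pi_sub, Real.sin_pi_sub,
    truncatedSlope]
  simp only [polarSlope, angularSpeed, parabolicDilation, mul_neg, hrev, ← neg_div]
  ring_nf

theorem strictMonoOn_parabolicDilation (hX : IsMonodromic X r₀ C M)
    (hH : HasIntegratingFactor X μ H)
    (hμ : ∀ z, 0 < μ z) {u : ℝ × ℝ} (hu : u ∈ unitCircle) :
    StrictMonoOn (fun ρ => H (parabolicDilation ρ u)) (Set.Ioc 0 (Real.exp r₀)) := by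
  have hderiv : ∀ ρ ∈ Set.Ioc 0 (Real.exp r₀), HasDerivAt (fun ρ => H (parabolicDilation ρ u))
      (-(μ (parabolicDilation ρ u) * angularSpeed X (parabolicDilation ρ u) / ρ)) ρ :=
    fun ρ hρ => hH.hasDerivAt_parabolicDilation hρ.1.ne' u
  refine strictMonoOn_of_deriv_pos (convex_Ioc _ _)
    (fun ρ hρ => (hderiv ρ hρ).continuousAt.continuousWithinAt) fun ρ hρ => ?_
  have hρ' := interior_subset hρ
  rw [(hderiv ρ hρ').deriv]
  exact neg_pos.2 (div_neg_of_neg_of_pos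
    (mul_neg_of_pos_of_neg (hμ _) (hX.angularSpeed_neg ρ hρ' u hu)) hρ'.1)

/-- A first integral is constant along the orbits and strictly monotone on the parabolic rays, so
an orbit meets a ray at the same point after each turn. -/
theorem isCenter_of_integratingFactor (hX : IsMonodromic X r₀ C M)
    (hH : HasIntegratingFactor X μ H)
    (hμ : ∀ z, 0 < μ z) : IsCenter X 0 := by
  refine hX.isCenter_of_return fun α hα a hle => ?_
  have ha : a ∈ Set.Icc a (a + 2 * Real.pi) :=
    Set.left_mem_Icc.2 (le_add_of_nonneg_right Real.two_pi_pos.le)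
  have hb : a + 2 * Real.pi ∈ Set.Icc a (a + 2 * Real.pi) :=
    Set.right_mem_Icc.2 (le_add_of_nonneg_right Real.two_pi_pos.le)
  have hderiv : ∀ θ ∈ Set.Icc a (a + 2 * Real.pi), HasDerivAt (H ∘ polarCurve α) 0 θ := by
    intro θ hθ
    refine ((hH _).comp_hasDerivAt θ
      (hX.hasDerivAt_polarCurve (hle θ hθ) (hα θ))).congr_deriv ?_
    simp only [smul_apply, sub_apply,
      ContinuousLinearMap.coe_fst', ContinuousLinearMap.coe_snd', smul_eq_mul, Prod.smul_fst,
      Prod.smul_snd]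
    ring
  have hclosed : H (polarCurve α (a + 2 * Real.pi)) = H (polarCurve α a) :=
    constant_of_has_deriv_right_zero (fun θ hθ => (hderiv θ hθ).continuousAt.continuousWithinAt)
      (fun θ hθ => (hderiv θ (Set.Ico_subset_Icc_self hθ)).hasDerivWithinAt) _ hb
  rw [polarCurve, Real.cos_add_two_pi, Real.sin_add_two_pi] at hclosed
  have hmem : ∀ θ ∈ Set.Icc a (a + 2 * Real.pi), Real.exp (α θ) ∈ Set.Ioc 0 (Real.exp r₀) :=
    fun θ hθ => ⟨Real.exp_pos _, Real.exp_le_exp.2 (hle θ hθ)⟩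
  exact Real.exp_injective ((hX.strictMonoOn_parabolicDilation hH hμ
    (cos_sin_mem_unitCircle a)).injOn (hmem _ hb) (hmem _ ha) hclosed)

end IsMonodromic

theorem exists_isMonodromic_cubicField (A B K L : ℝ) :
    ∃ r₀ C M, IsMonodromic (cubicField A B K L) r₀ C M := by
  refine exists_isMonodromic (d := 1)
    (Y := fun ρ => cubicField (ρ * A) (ρ ^ 2 * B) (ρ ^ 2 * K) (ρ ^ 3 * L)) (by simp [cubicField])
    (by unfold cubicField; fun_prop) (fun ρ _ u => ?_) (by unfold cubicField; fun_prop)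
    fun u hu => ?_
  · ext <;> simp only [cubicField, parabolicDilation, Prod.smul_fst, Prod.smul_snd,
      smul_eq_mul] <;> ring
  · have hval : angularSpeed (cubicField (0 * A) (0 ^ 2 * B) (0 ^ 2 * K) (0 ^ 3 * L)) u =
        -(u.1 ^ 4 + 2 * u.2 ^ 2) := by
      simp only [angularSpeed, cubicField]
      ring
    rw [hval, neg_lt_zero]
    by_contra! hle
    refine ne_zero_of_mem_unitCircle hu (Prod.ext ?_ ?_)
    · exact pow_eq_zero_iff four_ne_zero |>.1 (by nlinarith [sq_nonneg (u.1 ^ 2), sq_nonneg u.2])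
    · exact pow_eq_zero_iff two_ne_zero |>.1 (by nlinarith [sq_nonneg (u.1 ^ 2), sq_nonneg u.2])

/-- The first integral of the cubic system with `K = A ^ 2 / 2` and `L = A * B / 3`, which has the
integrating factor `exp (-A * x)`. -/
noncomputable def firstIntegral (A B : ℝ) (z : ℝ × ℝ) : ℝ :=
  Real.exp (-A * z.1) * (z.2 ^ 2 / 2 * (1 + A * z.1) + B * z.2 ^ 3 / 3) +
    ∫ u in (0 : ℝ)..z.1, u ^ 3 * Real.exp (-A * u)

theorem hasIntegratingFactor_cubicField (A B : ℝ) :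
    HasIntegratingFactor (cubicField A B (A ^ 2 / 2) (A * B / 3)) (fun z => Real.exp (-A * z.1))
      (firstIntegral A B) := by
  intro z
  have hc : Continuous fun u : ℝ => u ^ 3 * Real.exp (-A * u) := by fun_prop
  have hx : HasFDerivAt Prod.fst (ContinuousLinearMap.fst ℝ ℝ ℝ) z := hasFDerivAt_fst
  have hy : HasFDerivAt Prod.snd (ContinuousLinearMap.snd ℝ ℝ ℝ) z := hasFDerivAt_snd
  have hint := (hc.integral_hasStrictDerivAt 0 z.1).hasDerivAt.comp_hasFDerivAt z hx
  have hpoly := (((hy.pow 2).mul_const (1 / 2)).mul ((hx.const_mul A).const_add 1)).add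
    (((hy.pow 3).const_mul B).mul_const (1 / 3))
  have hfun : firstIntegral A B = fun z => Real.exp (-A * z.1) *
      (z.2 ^ 2 * (1 / 2) * (1 + A * z.1) + B * z.2 ^ 3 * (1 / 3)) +
        ∫ u in (0 : ℝ)..z.1, u ^ 3 * Real.exp (-A * u) := by
    funext z
    simp only [firstIntegral]
    ring
  rw [hfun]
  refine ((((hx.const_mul (-A)).exp).mul hpoly).add hint).congr_fderiv ?_
  ext <;> simp [cubicField] <;> ring

theorem isCenter_cubicField {A B K L : ℝ} (hL : A * B = 3 * L)
    (hK : A * B * (A ^ 2 - 2 * K) = 0) : IsCenter (cubicField A B K L) 0 := by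
  obtain ⟨r₀, C, M, hX⟩ := exists_isMonodromic_cubicField A B K L
  obtain rfl : L = A * B / 3 := by linarith
  rcases mul_eq_zero.1 hK with hAB | hAK
  · rcases mul_eq_zero.1 hAB with rfl | rfl
    · refine hX.isCenter_of_reversible_neg_fst fun x y => ?_
      ext <;> simp only [cubicField] <;> ring
    · refine hX.isCenter_of_reversible_neg_snd fun x y => ?_
      ext <;> simp only [cubicField] <;> ring
  · obtain rfl : K = A ^ 2 / 2 := by linarith
    exact hX.isCenter_of_integratingFactor (hasIntegratingFactor_cubicField A B) fun z =>
      Real.exp_pos _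

theorem hasNilpotentForm_cubicField (A B K L : ℝ) : HasNilpotentForm (cubicField A B K L) 0 := by
  have hfst : AnalyticAt ℝ (fun u : ℝ × ℝ => u.1) 0 := analyticAt_fst
  have hsnd : AnalyticAt ℝ (fun u : ℝ × ℝ => u.2) 0 := analyticAt_snd
  have hx : HasFDerivAt Prod.fst (ContinuousLinearMap.fst ℝ ℝ ℝ) (0 : ℝ × ℝ) := hasFDerivAt_fst
  have hy : HasFDerivAt Prod.snd (ContinuousLinearMap.snd ℝ ℝ ℝ) (0 : ℝ × ℝ) := hasFDerivAt_snd
  refine ⟨AffineEquiv.refl ℝ _, 1, fun u => A * u.1 * u.2 + B * u.2 ^ 2,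
    fun u => -u.1 ^ 3 + K * u.1 * u.2 ^ 2 + L * u.2 ^ 3, by simp, one_ne_zero, ?_, by simp, ?_,
    ?_, by simp, ?_, Filter.Eventually.of_forall fun u => by simp [cubicField, add_assoc]⟩
  · fun_prop
  · refine (((hx.const_mul A).mul hy).add ((hy.pow 2).const_mul B)).fderiv.trans ?_
    simp
  · fun_prop
  · refine ((((hx.pow 3).neg).add ((hx.const_mul K).mul (hy.pow 2))).add
      ((hy.pow 3).const_mul L)).fderiv.trans ?_
    simp

theorem mainTheorem6 (A B K L : ℝ) :
    IsNilpotentCenter (cubicField A B K L) (0, 0) ↔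
      A * B - 3 * L = 0 ∧ A * B * (A ^ 2 - 2 * K) = 0 := by
  rw [sub_eq_zero]
  constructor
  · rintro ⟨hcenter, -⟩
    exact ⟨mul_eq_three_mul_of_isCenter_cubicField hcenter,
      mul_mul_sub_eq_zero_of_isCenter_cubicField hcenter⟩
  · rintro ⟨hL, hK⟩
    exact ⟨isCenter_cubicField hL hK, hasNilpotentForm_cubicField A B K L⟩
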